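/- Let $1<\alpha<2$ and $\tfrac12\le r\le 1$, and let $\beta$ with $\alpha-1\le\beta\le 1$ and $\alpha-1\le\alpha-\beta\le 1$ be determined by \[ r=\frac{\sin(\pi\beta)}{\sin(\pi(\alpha-\beta))+\sin(\pi\beta)} . \] Write $\rho^{(a,b)}(x)=(1-x)^a x^b$. For $\omega>0$ on $(0,1)$ let $L^2_\omega(0,1)$ be the space of (classes of) real measurable functions $v$ on $(0,1)$ with $\|v\|_\omega^2=\int_0^1\omega v^2\,dx<\infty$. For a function $w$ on $(0,1)$ let \[ \mathcal N_r^\alpha w = D\big(r\,{}_0I_x^{2-\alpha}+(1-r)\,{}_xI_1^{2-\alpha}\big)w, \] where, for $0<\sigma<1$, \[ {}_0I_x^{\sigma}w(x)=\frac1{\Gamma(\sigma)}\int_0^x\frac{w(s)}{(x-s)^{1-\sigma}}\,ds,\qquad {}_xI_1^{\sigma}w(x)=\frac1{\Gamma(\sigma)}\int_x^1\frac{w(s)}{(s-x)^{1-\sigma}}\,ds, \] and $D$ is the weak derivative on $(0,1)$. Let $G_n^{(a,b)}(t)=P_n^{(a,b)}(2t-1)$ be the Jacobi polynomials transplanted to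 $(0,1)$, where \[ P_n^{(a,b)}(x)=2^{-n}\sum_{m=0}^n\binom{n+a}{m}\binom{n+b}{n-m}(x-1)^{n-m}(x+1)^m , \] and let $|\|G_n^{(a,b)}\||=\|G_n^{(a,b)}\|_{\rho^{(a,b)}}$. Put $k(x)=(1-x)^{\alpha-\beta-1}x^{\beta-1}$, $S=\sin(\pi(\alpha-\beta))+\sin(\pi\beta)$, \[ \lambda_{-1}=-\frac{\sin(\pi\alpha)}{S}\,\Gamma(\alpha),\qquad \lambda_n=\frac{\sin(\pi\alpha)}{S}\,\frac{\Gamma(n+\alpha)}{n!}\quad(n\ge 0). \] Let $f\in L^2_{\rho^{(\beta-1,\alpha-\beta-1)}}(0,1)$, and define \[ f_i=\int_0^1\rho^{(\beta-1,\alpha-\beta-1)} f\,G_i^{(\beta-1,\alpha-\beta-1)}\,dx\quad(i\ge0),\qquad c_i=\frac{f_{i+1}}{\lambda_i\,|\|G_{i+1}^{(\beta-1,\alpha-\beta-1)}\||^2}\quad(i\ge-1), \] \[ q_N(x)=c_{-1}\,x\,k(x)+\rho^{(\alpha-\beta,\beta)}(x)\sum_{i=0}^{N-1}c_i\,G_i^{(\alpha-\beta,\beta)}(x)\quad(N\ge0).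 \] Then $q_N-c_{-1}xk$ belongs to $L^2_{\rho^{(-(\alpha-\beta),-\beta)}}(0,1)$ for every $N$, and the sequence $(q_N-c_{-1}xk)_N$ converges in this space. If $q$ is defined by $q-c_{-1}xk=\lim_{N\to\infty}(q_N-c_{-1}xk)$, then $\mathcal N_r^\alpha q=f$ on $(0,1)$; that is, both fractional integrals of $q$ of order $2-\alpha$ converge absolutely at almost every point of $(0,1)$, and the weak derivative of $r\,{}_0I_x^{2-\alpha}q+(1-r)\,{}_xI_1^{2-\alpha}q$ on $(0,1)$ is $f$. -/

import Mathlib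

open MeasureTheory Set Filter Topology
open scoped ENNReal ContDiff

noncomputable section

namespace SpectralFDE

/-- The weight `ρ^{(a,b)}(x) = (1 - x)^a x^b`. -/
def rho (a b x : ℝ) : ℝ := (1 - x) ^ a * x ^ b

/-- The measure `ρ^{(a,b)}(x) dx` on `(0,1)`. The space `L²_{ρ^{(a,b)}}(0,1)` consists of the `f` with
`MemLp f 2 (weightedMeasure a b)`, and its norm is `eLpNorm f 2 (weightedMeasure a b)`. -/
def weightedMeasure (a b : ℝ) : Measure ℝ :=
  (volume.restrict (Ioo (0 : ℝ) 1)).withDensity fun x => ENNReal.ofReal (rho a b x)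

/-- The Jacobi polynomial `P_n^{(a,b)}` on `(-1,1)`; `Ring.choose z m` is the generalized binomial
coefficient `z (z - 1) ⋯ (z - m + 1) / m!`. -/
def jacobiP (n : ℕ) (a b x : ℝ) : ℝ :=
  ∑ m ∈ Finset.range (n + 1),
    (1 / 2 ^ n * Ring.choose ((n : ℝ) + a) m * Ring.choose ((n : ℝ) + b) (n - m)) *
      (x - 1) ^ (n - m) * (x + 1) ^ m

/-- The Jacobi polynomial transplanted to `(0,1)`: `G_n^{(a,b)}(t) = P_n^{(a,b)}(2 t - 1)`. -/
def jacobiG (n : ℕ) (a b t : ℝ) : ℝ := jacobiP n a b (2 * t - 1)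

/-- The square of the norm of `G_n^{(a,b)}` in `L²_{ρ^{(a,b)}}(0,1)`. -/
def normSqG (n : ℕ) (a b : ℝ) : ℝ :=
  ∫ x in Ioo (0 : ℝ) 1, rho a b x * jacobiG n a b x ^ 2

/-- The left fractional integral `₀I_x^σ w (x)`. -/
def leftFracInt (σ : ℝ) (w : ℝ → ℝ) (x : ℝ) : ℝ :=
  1 / Real.Gamma σ * ∫ s in Ioo 0 x, w s / (x - s) ^ (1 - σ)

/-- The right fractional integral `ₓI_1^σ w (x)`. -/
def rightFracInt (σ : ℝ) (w : ℝ → ℝ) (x : ℝ) : ℝ :=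
  1 / Real.Gamma σ * ∫ s in Ioo x 1, w s / (s - x) ^ (1 - σ)

/-- `(r ₀I_x^{2-α} + (1 - r) ₓI_1^{2-α}) w`. -/
def fracFlux (α r : ℝ) (w : ℝ → ℝ) (x : ℝ) : ℝ :=
  r * leftFracInt (2 - α) w x + (1 - r) * rightFracInt (2 - α) w x

/-- `g` is the weak derivative of `u` on `(0,1)`. -/
def HasWeakDeriv (u g : ℝ → ℝ) : Prop :=
  LocallyIntegrableOn u (Ioo 0 1) ∧ LocallyIntegrableOn g (Ioo 0 1) ∧
    ∀ φ : ℝ → ℝ, ContDiff ℝ ∞ φ → HasCompactSupport φ → tsupport φ ⊆ Ioo 0 1 →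
      ∫ x in Ioo (0 : ℝ) 1, u x * deriv φ x = -∫ x in Ioo (0 : ℝ) 1, g x * φ x

/-- `𝒩_r^α w = f` on `(0,1)`, where `𝒩_r^α w = D (r ₀I_x^{2-α} + (1 - r) ₓI_1^{2-α}) w`: both fractional
integrals of `w` converge absolutely at almost every point, and `f` is the weak derivative of the
combination of them. -/
def SolvesN (α r : ℝ) (w f : ℝ → ℝ) : Prop :=
  (∀ᵐ x ∂(volume.restrict (Ioo (0 : ℝ) 1)),
      IntegrableOn (fun s => w s / (x - s) ^ (1 - (2 - α))) (Ioo 0 x) ∧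
      IntegrableOn (fun s => w s / (s - x) ^ (1 - (2 - α))) (Ioo x 1)) ∧
    HasWeakDeriv (fracFlux α r w) f

/-- `k(x) = (1 - x)^{α-β-1} x^{β-1}`, which spans the kernel of `𝒩_r^α`. -/
def kerFun (α β x : ℝ) : ℝ := (1 - x) ^ (α - β - 1) * x ^ (β - 1)

/-- `λ_{-1}`, the constant value of `𝒩_r^α (x k(x))`. Since
`1 - r = sin (π (α - β)) / (sin (π (α - β)) + sin (π β))`, it is the number
`-(1 - r) Γ(α) sin (π α) / sin (π (α - β))`, in a form that makes sense for `r = 1` too. -/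
def lamNegOne (α β : ℝ) : ℝ :=
  -(Real.Gamma α * Real.sin (Real.pi * α) /
    (Real.sin (Real.pi * (α - β)) + Real.sin (Real.pi * β)))

/-- `λ_n` for `n ≥ 0`. -/
def lam (α β : ℝ) (n : ℕ) : ℝ :=
  Real.sin (Real.pi * α) / (Real.sin (Real.pi * (α - β)) + Real.sin (Real.pi * β)) *
    (Real.Gamma (n + α) / (n.factorial : ℝ))

/-- The coefficients `f_i = ∫₀¹ ρ^{(β-1,α-β-1)} f G_i^{(β-1,α-β-1)} dx`. -/
def fCoeff (α β : ℝ) (f : ℝ → ℝ) (i : ℕ) : ℝ :=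
  ∫ x in Ioo (0 : ℝ) 1,
    rho (β - 1) (α - β - 1) x * f x * jacobiG i (β - 1) (α - β - 1) x

/-- `c_{-1}`. -/
def cNegOne (α β : ℝ) (f : ℝ → ℝ) : ℝ :=
  1 / (lamNegOne α β * normSqG 0 (β - 1) (α - β - 1)) * fCoeff α β f 0

/-- `c_i` for `i ≥ 0`. -/
def cCoeff (α β : ℝ) (f : ℝ → ℝ) (i : ℕ) : ℝ :=
  1 / (lam α β i * normSqG (i + 1) (β - 1) (α - β - 1)) * fCoeff α β f (i + 1)

/-- The singular part `c_{-1} x k(x)`. -/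
def singPart (α β : ℝ) (f : ℝ → ℝ) (x : ℝ) : ℝ :=
  cNegOne α β f * x * kerFun α β x

/-- The spectral approximation
`q_N = c_{-1} x k(x) + ρ^{(α-β,β)}(x) ∑_{i < N} c_i G_i^{(α-β,β)}(x)`. -/
def qApprox (α β : ℝ) (f : ℝ → ℝ) (N : ℕ) (x : ℝ) : ℝ :=
  singPart α β f x +
    rho (α - β) β x * ∑ i ∈ Finset.range N, cCoeff α β f i * jacobiG i (α - β) β x

/-- `q - c_{-1} x k` is the limit of `q_N - c_{-1} x k` in `L²_{ρ^{(-(α-β),-β)}}(0,1)`. -/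
def IsSpectralLimit (α β : ℝ) (f q : ℝ → ℝ) : Prop :=
  MemLp (fun x => q x - singPart α β f x) 2 (weightedMeasure (-(α - β)) (-β)) ∧
    Tendsto
      (fun N : ℕ =>
        eLpNorm
          (fun x => (qApprox α β f N x - singPart α β f x) - (q x - singPart α β f x)) 2
          (weightedMeasure (-(α - β)) (-β)))
      atTop (𝓝 0)

end SpectralFDE

end

namespace SpectralFDE

open Polynomial

/-! Put γ = α - β, and let T be Γ(2-α) times the two-sided fractional integral: convolution on (0,1)
with the kernel equal to r z^{1-α} for z > 0 and (1-r)|z|^{1-α} for z < 0 (`fluxOp`). The theorem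
comes from diagonalising DT between two Jacobi bases.

The starting point is that T k is the constant π/S for k = ρ^{(γ-1,β-1)}
(`Admissible.lintegral_fluxKer`); this is where the relation between r and β enters. Since z times
the kernel is a primitive of (2-α) times the kernel, T(s w) equals x T w - (2-α) ∫ T w up to a
constant. Hence T(kP) is a polynomial of degree at most deg P, with an explicit leading coefficient
(`Admissible.exists_fluxOp_eq_eval`).

The adjoint of T replaces r by 1-r, that is, exchanges β and γ. So T(k G_n^{(γ-1,β-1)}) is
orthogonal, for the weight ρ^{(β-1,γ-1)}, to all polynomials of lower degree, and is a multiple of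
G_n^{(β-1,γ-1)} (`Admissible.fluxOp_jacobi`). By the Rodrigues formula, (ρ^{(γ,β)} G_n^{(γ,β)})' =
-(n+1) k G_{n+1}^{(γ-1,β-1)}; integration by parts gives DT(ρ^{(γ,β)} G_n^{(γ,β)}) = Γ(2-α) λ_n
G_{n+1}^{(β-1,γ-1)} (`Admissible.exists_fluxOp_rho_jacobi`), while DT(xk) = Γ(2-α) λ_{-1}. Thus q_N
is mapped to the partial sum of degree at most N of the Jacobi expansion of f.

The regular parts converge because |λ_n| is bounded below, the two families of norms compare, and
Bessel's inequality applies to f (`exists_isSpectralLimit`). In the weak formulation T is moved onto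
φ', where it gives a bounded function; q_N → q in L¹ handles that side, and Parseval for the
complete Jacobi system handles the other (`solvesN_of_isSpectralLimit`). -/

/-! ### Algebra of the Jacobi polynomials -/

lemma succ_mul_choose_succ (z : ℝ) (m : ℕ) :
    ((m : ℝ) + 1) * Ring.choose z (m + 1) = (z - m) * Ring.choose z m := by
  rw [Ring.choose_eq_smul, Ring.choose_eq_smul, descPochhammer_succ_right]
  have h1 : ((m.factorial : ℕ) : ℝ) ≠ 0 := by positivity
  have h2 : (m : ℝ) + 1 ≠ 0 := by positivity
  rw [Nat.factorial_succ]
  simp only [smul_eq_mul, Polynomial.smeval_mul, Polynomial.smeval_sub, Polynomial.smeval_X,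
    Polynomial.smeval_natCast, pow_zero, pow_one, nsmul_eq_mul, mul_one]
  push_cast
  field_simp

/-- The transplanted Jacobi polynomial as an element of `ℝ[X]`. -/
noncomputable def jacobiPoly (n : ℕ) (a b : ℝ) : ℝ[X] :=
  ∑ p ∈ Finset.HasAntidiagonal.antidiagonal n,
    C (Ring.choose ((n : ℝ) + a) p.1 * Ring.choose ((n : ℝ) + b) p.2) * (X - 1) ^ p.2 * X ^ p.1

lemma eval_jacobiPoly (n : ℕ) (a b x : ℝ) : (jacobiPoly n a b).eval x = jacobiG n a b x := by
  rw [jacobiPoly, jacobiG, jacobiP, eval_finsetSum,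
    Finset.Nat.sum_antidiagonal_eq_sum_range_succ_mk]
  refine Finset.sum_congr rfl fun m hm => ?_
  have hm' : m ≤ n := Nat.lt_succ_iff.mp (Finset.mem_range.mp hm)
  have h1 : (2 * x - 1 - 1) = 2 * (x - 1) := by ring
  have h2 : (2 * x - 1 + 1) = 2 * x := by ring
  have h3 : (2 : ℝ) ^ n = 2 ^ (n - m) * 2 ^ m := by rw [← pow_add]; congr 1; omega
  simp only [eval_mul, eval_C, eval_pow, eval_sub, eval_X, eval_one]
  -- The substitution 2x - 1 produces 2^{n-m} and 2^m, which absorb the normalising factor 2^{-n}.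
  rw [h1, h2, mul_pow, mul_pow, h3]
  field_simp

/-- In each of the two sums of the product rule the boundary term drops out. After an index shift
both run over the antidiagonal of n, and `succ_mul_choose_succ` contributes the factors n+b+1-p.2
and n+a+1-p.1, whose sum is n+a+b+2. -/
lemma derivative_jacobiPoly_succ (n : ℕ) (a b : ℝ) :
    derivative (jacobiPoly (n + 1) a b) =
      C ((n : ℝ) + a + b + 2) * jacobiPoly n (a + 1) (b + 1) := by
  have key : derivative (jacobiPoly (n + 1) a b) =
      (∑ p ∈ Finset.HasAntidiagonal.antidiagonal (n + 1),
        C (Ring.choose ((n + 1 : ℕ) + a) p.1 * Ring.choose ((n + 1 : ℕ) + b) p.2) *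
          ((p.2 : ℝ[X]) * (X - 1 : ℝ[X]) ^ (p.2 - 1)) * X ^ p.1) +
      ∑ p ∈ Finset.HasAntidiagonal.antidiagonal (n + 1),
        C (Ring.choose ((n + 1 : ℕ) + a) p.1 * Ring.choose ((n + 1 : ℕ) + b) p.2) *
          (X - 1) ^ p.2 * ((p.1 : ℝ[X]) * (X : ℝ[X]) ^ (p.1 - 1)) := by
    rw [jacobiPoly, derivative_sum, ← Finset.sum_add_distrib]
    refine Finset.sum_congr rfl fun p _ => ?_
    simp only [derivative_mul, derivative_C, derivative_pow, derivative_sub, derivative_X,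
      derivative_one]
    simp
  rw [key, Finset.Nat.sum_antidiagonal_succ', Finset.Nat.sum_antidiagonal_succ, jacobiPoly,
    Finset.mul_sum]
  simp only [Nat.cast_zero, zero_mul, mul_zero, zero_add, Nat.add_sub_cancel]
  rw [← Finset.sum_add_distrib]
  refine Finset.sum_congr rfl fun p hp => ?_
  have hn : (n : ℝ) = p.1 + p.2 := by
    rw [← Finset.HasAntidiagonal.mem_antidiagonal.mp hp]; push_cast; ring
  have e1 : ((n + 1 : ℕ) : ℝ) + a = n + (a + 1) := by push_cast; ring
  have e2 : ((n + 1 : ℕ) : ℝ) + b = n + (b + 1) := by push_cast; ring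
  rw [e1, e2]
  have h1 := succ_mul_choose_succ ((n : ℝ) + (a + 1)) p.1
  have h2 := succ_mul_choose_succ ((n : ℝ) + (b + 1)) p.2
  have hc : Ring.choose ((n : ℝ) + (a + 1)) p.1 * Ring.choose ((n : ℝ) + (b + 1)) (p.2 + 1) *
        ((p.2 : ℝ) + 1) +
      Ring.choose ((n : ℝ) + (a + 1)) (p.1 + 1) * Ring.choose ((n : ℝ) + (b + 1)) p.2 *
        ((p.1 : ℝ) + 1) =
      ((n : ℝ) + a + b + 2) *
        (Ring.choose ((n : ℝ) + (a + 1)) p.1 * Ring.choose ((n : ℝ) + (b + 1)) p.2) := by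
    linear_combination Ring.choose ((n : ℝ) + (a + 1)) p.1 * h2 +
      Ring.choose ((n : ℝ) + (b + 1)) p.2 * h1 +
      Ring.choose ((n : ℝ) + (a + 1)) p.1 * Ring.choose ((n : ℝ) + (b + 1)) p.2 * hn
  have hC := congrArg (C : ℝ → ℝ[X]) hc
  simp only [C_add, C_mul, map_natCast, map_one] at hC ⊢
  push_cast
  linear_combination (X - 1) ^ p.2 * X ^ p.1 * hC

/-- One step of the Rodrigues formula, with the weight ρ^{(a,b)} divided out. Splitting n+1 = p.1 +
p.2 in every term of the right-hand side lets each part be absorbed into one binomial coefficient;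
the rest is a comparison term by term. -/
lemma rodrigues_step (n : ℕ) (a b : ℝ) :
    X * (1 - X) * derivative (jacobiPoly n (a + 1) (b + 1)) +
      (C (b + 1) * (1 - X) - C (a + 1) * X) * jacobiPoly n (a + 1) (b + 1) =
    -(C ((n : ℝ) + 1) * jacobiPoly (n + 1) a b) := by
  have key : C ((n : ℝ) + 1) * jacobiPoly (n + 1) a b =
      (∑ p ∈ Finset.HasAntidiagonal.antidiagonal (n + 1),
        C (Ring.choose ((n + 1 : ℕ) + a) p.1 * (p.2 * Ring.choose ((n + 1 : ℕ) + b) p.2)) *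
          (X - 1) ^ p.2 * X ^ p.1) +
      ∑ p ∈ Finset.HasAntidiagonal.antidiagonal (n + 1),
        C (p.1 * Ring.choose ((n + 1 : ℕ) + a) p.1 * Ring.choose ((n + 1 : ℕ) + b) p.2) *
          (X - 1) ^ p.2 * X ^ p.1 := by
    rw [jacobiPoly, Finset.mul_sum, ← Finset.sum_add_distrib]
    refine Finset.sum_congr rfl fun p hp => ?_
    have hn : (n : ℝ) + 1 = p.1 + p.2 := by
      exact_mod_cast (Finset.HasAntidiagonal.mem_antidiagonal.mp hp).symm
    rw [hn]
    simp only [C_add, C_mul]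
    ring
  rw [key, Finset.Nat.sum_antidiagonal_succ', Finset.Nat.sum_antidiagonal_succ, jacobiPoly,
    derivative_sum, Finset.mul_sum, Finset.mul_sum]
  simp only [Nat.cast_zero, zero_mul, mul_zero, zero_add, C_0]
  rw [← Finset.sum_add_distrib, ← Finset.sum_add_distrib, ← Finset.sum_neg_distrib]
  refine Finset.sum_congr rfl fun p hp => ?_
  have hn : (n : ℝ) = p.1 + p.2 := by
    rw [← Finset.HasAntidiagonal.mem_antidiagonal.mp hp]; push_cast; ring
  have e1 : ((n + 1 : ℕ) : ℝ) + a = n + (a + 1) := by push_cast; ring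
  have e2 : ((n + 1 : ℕ) : ℝ) + b = n + (b + 1) := by push_cast; ring
  rw [e1, e2]
  push_cast
  rw [succ_mul_choose_succ, succ_mul_choose_succ]
  have f1 : (n : ℝ) + (a + 1) - p.1 = p.2 + (a + 1) := by rw [hn]; ring
  have f2 : (n : ℝ) + (b + 1) - p.2 = p.1 + (b + 1) := by rw [hn]; ring
  rw [f1, f2]
  have g1 : (X - 1 : ℝ[X]) * ((p.2 : ℝ[X]) * (X - 1 : ℝ[X]) ^ (p.2 - 1)) =
      (p.2 : ℝ[X]) * (X - 1 : ℝ[X]) ^ p.2 := by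
    rcases p.2 with _ | m
    · simp
    · rw [Nat.add_sub_cancel]; ring
  have g2 : (X : ℝ[X]) * ((p.1 : ℝ[X]) * (X : ℝ[X]) ^ (p.1 - 1)) =
      (p.1 : ℝ[X]) * (X : ℝ[X]) ^ p.1 := by
    rcases p.1 with _ | m
    · simp
    · rw [Nat.add_sub_cancel]; ring
  have hd : derivative (C (Ring.choose ((n : ℝ) + (a + 1)) p.1 *
        Ring.choose ((n : ℝ) + (b + 1)) p.2) * (X - 1) ^ p.2 * X ^ p.1) =
      C (Ring.choose ((n : ℝ) + (a + 1)) p.1 * Ring.choose ((n : ℝ) + (b + 1)) p.2) *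
        ((p.2 : ℝ[X]) * (X - 1 : ℝ[X]) ^ (p.2 - 1) * X ^ p.1 +
          (X - 1) ^ p.2 * ((p.1 : ℝ[X]) * (X : ℝ[X]) ^ (p.1 - 1))) := by
    simp only [derivative_mul, derivative_C, derivative_pow, derivative_sub, derivative_X,
      derivative_one]
    simp
    ring
  rw [hd]
  simp only [C_add, C_mul, map_natCast, map_one]
  generalize C (Ring.choose ((n : ℝ) + (a + 1)) p.1) = u
  generalize C (Ring.choose ((n : ℝ) + (b + 1)) p.2) = v
  linear_combination (-X) * X ^ p.1 * u * v * g1 - (X - 1) * u * v * (X - 1) ^ p.2 * g2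

lemma jacobiPoly_zero (a b : ℝ) : jacobiPoly 0 a b = 1 := by
  simp [jacobiPoly]

lemma natDegree_jacobiPoly_le (n : ℕ) (a b : ℝ) : (jacobiPoly n a b).natDegree ≤ n := by
  refine natDegree_sum_le_of_forall_le _ _ fun p hp => ?_
  have h : p.1 + p.2 = n := Finset.HasAntidiagonal.mem_antidiagonal.mp hp
  have hX : (X - 1 : ℝ[X]).natDegree ≤ 1 := by
    simpa using natDegree_X_sub_C_le (1 : ℝ)
  calc _ ≤ (C (Ring.choose ((n : ℝ) + a) p.1 * Ring.choose ((n : ℝ) + b) p.2) *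
        (X - 1) ^ p.2 : ℝ[X]).natDegree + (X ^ p.1 : ℝ[X]).natDegree := natDegree_mul_le
    _ ≤ p.2 + p.1 := by
      refine add_le_add ((natDegree_C_mul_le _ _).trans ?_) (natDegree_X_pow_le _)
      simpa using natDegree_pow_le_of_le p.2 hX
    _ = n := by omega

lemma coeff_jacobiPoly_succ (n : ℕ) (a b : ℝ) :
    (jacobiPoly (n + 1) a b).coeff (n + 1) * ((n : ℝ) + 1) =
      ((n : ℝ) + a + b + 2) * (jacobiPoly n (a + 1) (b + 1)).coeff n := by
  have h := congrArg (fun P : ℝ[X] => P.coeff n) (derivative_jacobiPoly_succ n a b)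
  simpa only [coeff_derivative, coeff_C_mul] using h

/-- The derivative recurrence for leading coefficients sees a and b only through a+b. This makes
leading coefficients comparable when `fluxOp` exchanges the two parameters. -/
lemma coeff_jacobiPoly_comm (n : ℕ) : ∀ a b : ℝ,
    (jacobiPoly n a b).coeff n = (jacobiPoly n b a).coeff n := by
  induction n with
  | zero => intro a b; simp [jacobiPoly_zero]
  | succ n ih =>
    intro a b
    have h1 := coeff_jacobiPoly_succ n a b
    have h2 := coeff_jacobiPoly_succ n b a
    rw [ih] at h1
    have h3 : ((n : ℝ) + 1) ≠ 0 := by positivity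
    apply mul_right_cancel₀ h3
    rw [h1, h2]; ring

lemma coeff_jacobiPoly_pos (n : ℕ) : ∀ a b : ℝ, -1 < a → -1 < b →
    0 < (jacobiPoly n a b).coeff n := by
  induction n with
  | zero => intro a b _ _; simp [jacobiPoly_zero]
  | succ n ih =>
    intro a b ha hb
    have h1 := coeff_jacobiPoly_succ n a b
    have h2 := ih (a + 1) (b + 1) (by linarith) (by linarith)
    have h3 : (0 : ℝ) < n + a + b + 2 := by
      have : (0 : ℝ) ≤ n := Nat.cast_nonneg n
      linarith
    have h4 : (0 : ℝ) < (n : ℝ) + 1 := by positivity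
    have h5 := mul_pos h3 h2
    rw [← h1] at h5
    exact pos_of_mul_pos_left h5 h4.le

lemma degree_jacobiPoly (n : ℕ) {a b : ℝ} (ha : -1 < a) (hb : -1 < b) :
    (jacobiPoly n a b).degree = n := by
  refine le_antisymm (degree_le_of_natDegree_le (natDegree_jacobiPoly_le n a b)) ?_
  exact le_degree_of_ne_zero (coeff_jacobiPoly_pos n a b ha hb).ne'

lemma jacobiG_one_sub (n : ℕ) (a b x : ℝ) :
    jacobiG n a b (1 - x) = (-1) ^ n * jacobiG n b a x := by
  rw [← eval_jacobiPoly, ← eval_jacobiPoly, jacobiPoly, jacobiPoly, eval_finsetSum,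
    eval_finsetSum, ← Finset.Nat.sum_antidiagonal_swap, Finset.mul_sum]
  refine Finset.sum_congr rfl fun p hp => ?_
  have h : p.1 + p.2 = n := Finset.HasAntidiagonal.mem_antidiagonal.mp hp
  simp only [eval_mul, eval_C, eval_pow, eval_sub, eval_X, eval_one, Prod.fst_swap, Prod.snd_swap]
  rw [← h, pow_add, show 1 - x - 1 = (-1) * x by ring, show 1 - x = (-1) * (x - 1) by ring,
    mul_pow, mul_pow]
  ring

/-! ### The Jacobi weights and their integrability -/

lemma rho_pos (a b : ℝ) {x : ℝ} (hx : x ∈ Ioo (0 : ℝ) 1) : 0 < rho a b x :=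
  mul_pos (Real.rpow_pos_of_pos (by linarith [hx.2]) _) (Real.rpow_pos_of_pos hx.1 _)

lemma measurable_rho (a b : ℝ) : Measurable (rho a b) := by
  unfold rho; fun_prop

lemma rho_one_sub (a b x : ℝ) : rho a b (1 - x) = rho b a x := by
  simp [rho, mul_comm]

lemma rho_add_one_add_one (a b : ℝ) {x : ℝ} (hx : x ∈ Ioo (0 : ℝ) 1) :
    rho (a + 1) (b + 1) x = rho a b x * (x * (1 - x)) := by
  have h1 : 0 < 1 - x := by linarith [hx.2]
  rw [rho, rho, Real.rpow_add_one h1.ne', Real.rpow_add_one hx.1.ne']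
  ring

lemma lintegral_beta {p q : ℝ} (hp : 0 < p) (hq : 0 < q) :
    ∫⁻ x in Ioo (0 : ℝ) 1, ENNReal.ofReal (x ^ (p - 1) * (1 - x) ^ (q - 1)) =
      ENNReal.ofReal (ProbabilityTheory.beta p q) := by
  have hB := ProbabilityTheory.beta_pos hp hq
  have h := ProbabilityTheory.lintegral_betaPDF_eq_one hp hq
  rw [ProbabilityTheory.lintegral_betaPDF] at h
  have h2 : ∀ x : ℝ, ENNReal.ofReal (1 / ProbabilityTheory.beta p q * x ^ (p - 1) *
      (1 - x) ^ (q - 1)) = ENNReal.ofReal (1 / ProbabilityTheory.beta p q) *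
        ENNReal.ofReal (x ^ (p - 1) * (1 - x) ^ (q - 1)) := fun x => by
    rw [mul_assoc, ENNReal.ofReal_mul (by positivity)]
  simp_rw [h2] at h
  rw [lintegral_const_mul _ (by fun_prop)] at h
  have h3 := congrArg (fun y => ENNReal.ofReal (ProbabilityTheory.beta p q) * y) h
  rw [← mul_assoc, ← ENNReal.ofReal_mul hB.le, mul_one_div_cancel hB.ne', ENNReal.ofReal_one,
    one_mul, mul_one] at h3
  exact h3

lemma integrableOn_rho {a b : ℝ} (ha : -1 < a) (hb : -1 < b) :
    IntegrableOn (rho a b) (Ioo 0 1) := by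
  refine ⟨(measurable_rho a b).aestronglyMeasurable, ?_⟩
  rw [hasFiniteIntegral_iff_ofReal]
  · have h := lintegral_beta (p := b + 1) (q := a + 1) (by linarith) (by linarith)
    simp only [add_sub_cancel_right] at h
    simp_rw [rho, mul_comm ((1 - _) ^ a : ℝ)]
    rw [h]
    exact ENNReal.ofReal_lt_top
  · exact ae_restrict_of_forall_mem measurableSet_Ioo fun x hx => (rho_pos a b hx).le

lemma integrableOn_rho_mul {a b : ℝ} (ha : -1 < a) (hb : -1 < b) {g : ℝ → ℝ}
    (hg : Continuous g) : IntegrableOn (fun x => rho a b x * g x) (Ioo 0 1) :=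
  (integrableOn_rho ha hb).mul_continuousOn_of_subset hg.continuousOn measurableSet_Ioo
    isCompact_Icc Ioo_subset_Icc_self

lemma integrableOn_rho_mul_eval {a b : ℝ} (ha : -1 < a) (hb : -1 < b) (P : ℝ[X]) :
    IntegrableOn (fun x => rho a b x * P.eval x) (Ioo 0 1) :=
  integrableOn_rho_mul ha hb P.continuous

/-! ### Integration by parts, orthogonality and norms -/

/-- The polynomial `Q` with `(ρ^{(a+1,b+1)} P)' = ρ^{(a,b)} Q`. -/
noncomputable def weightedDeriv (a b : ℝ) (P : ℝ[X]) : ℝ[X] :=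
  X * (1 - X) * derivative P + (C (b + 1) * (1 - X) - C (a + 1) * X) * P

lemma weightedDeriv_mul (a b : ℝ) (P Q : ℝ[X]) :
    weightedDeriv a b (P * Q) = weightedDeriv a b P * Q + X * (1 - X) * (P * derivative Q) := by
  simp only [weightedDeriv, derivative_mul]
  ring

lemma hasDerivAt_rho_mul_eval (a b : ℝ) (P : ℝ[X]) {x : ℝ} (hx : x ∈ Ioo (0 : ℝ) 1) :
    HasDerivAt (fun y => rho (a + 1) (b + 1) y * P.eval y)
      (rho a b x * (weightedDeriv a b P).eval x) x := by
  have h1 : 0 < 1 - x := by linarith [hx.2]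
  have d1 : HasDerivAt (fun y : ℝ => (1 - y) ^ (a + 1)) (-((a + 1) * (1 - x) ^ a)) x := by
    have := ((hasDerivAt_id x).const_sub 1).rpow_const (p := a + 1) (Or.inl h1.ne')
    refine this.congr_deriv ?_
    simp only [id, add_sub_cancel_right]
    ring
  have d2 : HasDerivAt (fun y : ℝ => y ^ (b + 1)) ((b + 1) * x ^ b) x := by
    have := Real.hasDerivAt_rpow_const (x := x) (p := b + 1) (Or.inl hx.1.ne')
    simpa using this
  have := (d1.mul d2).mul (P.hasDerivAt x)
  refine this.congr_deriv ?_
  simp only [weightedDeriv, rho, eval_add, eval_mul, eval_sub, eval_X, eval_one, eval_C,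
    Pi.mul_apply]
  rw [Real.rpow_add_one h1.ne', Real.rpow_add_one hx.1.ne']
  ring

lemma continuousOn_rho {a b : ℝ} (ha : 0 ≤ a) (hb : 0 ≤ b) : ContinuousOn (rho a b) (Icc 0 1) := by
  unfold rho
  exact ((continuous_const.sub continuous_id).continuousOn.rpow_const fun x _ => Or.inr ha).mul
    (continuousOn_id.rpow_const fun x _ => Or.inr hb)

lemma rho_zero_right {a b : ℝ} (hb : b ≠ 0) : rho a b 0 = 0 := by simp [rho, hb]

lemma rho_one_right {a b : ℝ} (ha : a ≠ 0) : rho a b 1 = 0 := by simp [rho, ha]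

lemma integral_rho_mul_weightedDeriv {a b : ℝ} (ha : -1 < a) (hb : -1 < b) (P : ℝ[X]) :
    ∫ x in Ioo (0 : ℝ) 1, rho a b x * (weightedDeriv a b P).eval x = 0 := by
  rw [← integral_Ioc_eq_integral_Ioo, ← intervalIntegral.integral_of_le zero_le_one]
  rw [integral_eq_of_hasDerivAt_off_countable_of_le
    (fun y => rho (a + 1) (b + 1) y * P.eval y) _ zero_le_one countable_empty]
  · rw [rho_zero_right (by linarith), rho_one_right (by linarith)]
    simp
  · exact (continuousOn_rho (by linarith) (by linarith)).mul P.continuous.continuousOn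
  · intro x hx
    exact hasDerivAt_rho_mul_eval a b P hx.1
  · rw [intervalIntegrable_iff_integrableOn_Ioo_of_le zero_le_one]
    exact integrableOn_rho_mul_eval ha hb _

lemma integral_weightedDeriv_mul {a b : ℝ} (ha : -1 < a) (hb : -1 < b) (P Q : ℝ[X]) :
    ∫ x in Ioo (0 : ℝ) 1, rho a b x * (weightedDeriv a b P * Q).eval x =
      -∫ x in Ioo (0 : ℝ) 1, rho (a + 1) (b + 1) x * (P * derivative Q).eval x := by
  have h := integral_rho_mul_weightedDeriv ha hb (P * Q)
  rw [weightedDeriv_mul] at h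
  have h2 : ∫ x in Ioo (0 : ℝ) 1, rho (a + 1) (b + 1) x * (P * derivative Q).eval x =
      ∫ x in Ioo (0 : ℝ) 1, rho a b x * (X * (1 - X) * (P * derivative Q)).eval x := by
    refine setIntegral_congr_fun measurableSet_Ioo fun x hx => ?_
    simp only [rho_add_one_add_one a b hx, eval_mul, eval_X, eval_sub, eval_one]
    ring
  rw [h2, eq_neg_iff_add_eq_zero, ← integral_add (integrableOn_rho_mul_eval ha hb _).integrable
    (integrableOn_rho_mul_eval ha hb _).integrable]
  refine Eq.trans ?_ h
  refine integral_congr_ae (Eventually.of_forall fun x => ?_)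
  simp only [eval_add]
  ring

lemma weightedDeriv_jacobiPoly (n : ℕ) (a b : ℝ) :
    weightedDeriv a b (jacobiPoly n (a + 1) (b + 1)) =
      -(C ((n : ℝ) + 1) * jacobiPoly (n + 1) a b) := rodrigues_step n a b

/-- Rodrigues followed by integration by parts: lowering n by one and raising both parameters by one
costs one derivative of Q. Orthogonality (differentiate Q to zero) and the norm recurrence (Q the
same Jacobi polynomial) both follow. -/
lemma integral_jacobiPoly_succ_mul (n : ℕ) {a b : ℝ} (ha : -1 < a) (hb : -1 < b) (Q : ℝ[X]) :
    ((n : ℝ) + 1) * ∫ x in Ioo (0 : ℝ) 1, rho a b x * (jacobiPoly (n + 1) a b * Q).eval x =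
      ∫ x in Ioo (0 : ℝ) 1,
        rho (a + 1) (b + 1) x * (jacobiPoly n (a + 1) (b + 1) * derivative Q).eval x := by
  have h := integral_weightedDeriv_mul ha hb (jacobiPoly n (a + 1) (b + 1)) Q
  rw [weightedDeriv_jacobiPoly] at h
  rw [← neg_inj, ← h, ← integral_const_mul, ← integral_neg]
  refine integral_congr_ae (Eventually.of_forall fun x => ?_)
  simp only [eval_mul, eval_neg, eval_C]
  ring

lemma integral_jacobiPoly_mul_eq_zero (n : ℕ) : ∀ {a b : ℝ}, -1 < a → -1 < b →
    ∀ {Q : ℝ[X]}, Q.degree < n →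
      ∫ x in Ioo (0 : ℝ) 1, rho a b x * (jacobiPoly n a b * Q).eval x = 0 := by
  induction n with
  | zero =>
    intro a b _ _ Q hQ
    have : Q = 0 := by simpa [degree_lt_iff_coeff_zero, Polynomial.ext_iff] using hQ
    simp [this]
  | succ n ih =>
    intro a b ha hb Q hQ
    have h := integral_jacobiPoly_succ_mul n ha hb Q
    rw [ih (by linarith) (by linarith)] at h
    · exact (mul_eq_zero.mp h).resolve_left (by positivity)
    · rw [degree_lt_iff_coeff_zero] at hQ ⊢
      intro m hm
      rw [coeff_derivative, hQ (m + 1) (by omega), zero_mul]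

lemma normSqG_eq (n : ℕ) (a b : ℝ) :
    normSqG n a b =
      ∫ x in Ioo (0 : ℝ) 1, rho a b x * (jacobiPoly n a b * jacobiPoly n a b).eval x := by
  simp only [normSqG, eval_mul, eval_jacobiPoly, pow_two]

lemma normSqG_succ (n : ℕ) {a b : ℝ} (ha : -1 < a) (hb : -1 < b) :
    ((n : ℝ) + 1) * normSqG (n + 1) a b =
      ((n : ℝ) + a + b + 2) * normSqG n (a + 1) (b + 1) := by
  rw [normSqG_eq, integral_jacobiPoly_succ_mul n ha hb, normSqG_eq, derivative_jacobiPoly_succ,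
    ← integral_const_mul]
  refine integral_congr_ae (Eventually.of_forall fun x => ?_)
  simp only [eval_mul, eval_C]
  ring

lemma normSqG_pos (n : ℕ) : ∀ {a b : ℝ}, -1 < a → -1 < b → 0 < normSqG n a b := by
  induction n with
  | zero =>
    intro a b ha hb
    rw [normSqG_eq, jacobiPoly_zero]
    simp only [mul_one, eval_one]
    rw [setIntegral_pos_iff_support_of_nonneg_ae]
    · have : Function.support (rho a b) ∩ Ioo 0 1 = Ioo 0 1 :=
        inter_eq_right.mpr fun x hx => (rho_pos a b hx).ne'
      rw [this]; simp
    · exact ae_restrict_of_forall_mem measurableSet_Ioo fun x hx => (rho_pos a b hx).le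
    · exact integrableOn_rho ha hb
  | succ n ih =>
    intro a b ha hb
    have h := normSqG_succ n ha hb
    have h1 := ih (a := a + 1) (b := b + 1) (by linarith) (by linarith)
    have h3 : (0 : ℝ) < n + a + b + 2 := by
      have : (0 : ℝ) ≤ n := Nat.cast_nonneg n
      linarith
    have h4 := mul_pos h3 h1
    rw [← h] at h4
    exact pos_of_mul_pos_right h4 (by positivity)

lemma integral_Ioo_one_sub (F : ℝ → ℝ) :
    ∫ x in Ioo (0 : ℝ) 1, F (1 - x) = ∫ x in Ioo (0 : ℝ) 1, F x := by
  rw [← integral_Ioc_eq_integral_Ioo, ← intervalIntegral.integral_of_le zero_le_one,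
    ← integral_Ioc_eq_integral_Ioo, ← intervalIntegral.integral_of_le zero_le_one,
    intervalIntegral.integral_comp_sub_left]
  simp

lemma normSqG_comm (n : ℕ) (a b : ℝ) : normSqG n a b = normSqG n b a := by
  rw [normSqG, ← integral_Ioo_one_sub, normSqG]
  refine integral_congr_ae (Eventually.of_forall fun x => ?_)
  simp only [rho_one_sub, jacobiG_one_sub]
  rw [mul_pow, ← pow_mul, mul_comm n 2, pow_mul]
  simp

/-- A nonnegative integrand with zero integral vanishes almost everywhere, while a nonzero
polynomial has only finitely many roots. -/
lemma eq_zero_of_integral_rho_mul_self {a b : ℝ} (ha : -1 < a) (hb : -1 < b) {P : ℝ[X]}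
    (h : ∫ x in Ioo (0 : ℝ) 1, rho a b x * (P * P).eval x = 0) : P = 0 := by
  rw [setIntegral_eq_zero_iff_of_nonneg_ae] at h
  · by_contra hP
    have hfin : (P.rootSet ℝ).Finite := P.rootSet_finite ℝ
    have h2 : ∀ᵐ x ∂(volume.restrict (Ioo (0 : ℝ) 1)), x ∈ P.rootSet ℝ := by
      filter_upwards [h, ae_restrict_mem measurableSet_Ioo] with x hx hx'
      have := (rho_pos a b hx').ne'
      simp only [Pi.zero_apply, eval_mul, mul_eq_zero, this, false_or, or_self] at hx
      rw [mem_rootSet]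
      exact ⟨hP, by simpa using hx⟩
    have h3 : ∀ᵐ x ∂(volume.restrict (Ioo (0 : ℝ) 1)), x ∉ P.rootSet ℝ :=
      ae_restrict_of_ae (hfin.countable.ae_notMem _)
    have h4 : ∀ᵐ x ∂(volume.restrict (Ioo (0 : ℝ) 1)), False := by
      filter_upwards [h2, h3] with x h2 h3 using h3 h2
    rw [ae_iff] at h4
    simp at h4
  · refine ae_restrict_of_forall_mem measurableSet_Ioo fun x hx => ?_
    simp only [Pi.zero_apply, eval_mul]
    exact mul_nonneg (rho_pos a b hx).le (mul_self_nonneg _)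
  · exact integrableOn_rho_mul_eval ha hb _

/-! ### Beta integrals -/

open ProbabilityTheory (beta beta_pos)

lemma lintegral_Ioo_one_sub (a b : ℝ) (g : ℝ → ℝ≥0∞) :
    ∫⁻ s in Ioo a b, g (1 - s) = ∫⁻ s in Ioo (1 - b) (1 - a), g s := by
  rw [← image_const_sub_Ioo, lintegral_image_eq_lintegral_abs_deriv_mul measurableSet_Ioo
    (f' := fun _ => -1)]
  · simp
  · intro x _
    simpa using ((hasDerivAt_id x).const_sub 1).hasDerivWithinAt
  · intro x _ y _ h
    simpa using h

lemma lintegral_beta_interval {t x p q : ℝ} (htx : t < x) (hp : 0 < p) (hq : 0 < q) :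
    ∫⁻ s in Ioo t x, ENNReal.ofReal ((x - s) ^ (p - 1) * (s - t) ^ (q - 1)) =
      ENNReal.ofReal (beta q p * (x - t) ^ (p + q - 1)) := by
  have hd : 0 < x - t := by linarith
  have himg : (fun v : ℝ => t + (x - t) * v) '' Ioo 0 1 = Ioo t x := by
    ext s
    constructor
    · rintro ⟨v, hv, rfl⟩
      constructor <;> simp only <;> nlinarith [hv.1, hv.2]
    · intro hs
      refine ⟨(s - t) / (x - t), ⟨div_pos (by linarith [hs.1]) hd, ?_⟩, ?_⟩
      · rw [div_lt_one hd]; linarith [hs.2]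
      · field_simp; ring
  rw [← himg, lintegral_image_eq_lintegral_abs_deriv_mul measurableSet_Ioo
    (f' := fun _ => x - t)]
  · rw [mul_comm (beta q p), ENNReal.ofReal_mul (by positivity), ← lintegral_beta hq hp,
      ← lintegral_const_mul _ (by fun_prop)]
    refine setLIntegral_congr_fun measurableSet_Ioo fun v hv => ?_
    have hv1 : 0 < 1 - v := by linarith [hv.2]
    rw [← ENNReal.ofReal_mul (by positivity), ← ENNReal.ofReal_mul (by positivity), abs_of_pos hd,
      show x - (t + (x - t) * v) = (x - t) * (1 - v) by ring,
      show t + (x - t) * v - t = (x - t) * v by ring, Real.mul_rpow hd.le hv1.le,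
      Real.mul_rpow hd.le hv.1.le, show p + q - 1 = 1 + (p - 1) + (q - 1) by ring,
      Real.rpow_add hd, Real.rpow_add hd, Real.rpow_one]
    congr 1; ring
  · intro v _
    simpa using (((hasDerivAt_id v).const_mul (x - t)).const_add t).hasDerivWithinAt
  · intro v _ w _ h
    simpa [hd.ne'] using h

/-- The Möbius map v ↦ sv/(1-s+sv) sends (0,1) onto (0,s). The exponent -p-q is the one for which
all powers of the denominator, including the -2 from the Jacobian, cancel, leaving a complete beta
integral in v. -/
lemma lintegral_beta_moebius {s p q : ℝ} (hs : s ∈ Ioo (0 : ℝ) 1) (hp : 0 < p) (hq : 0 < q) :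
    ∫⁻ t in Ioo 0 s, ENNReal.ofReal ((s - t) ^ (p - 1) * (t ^ (q - 1) * (1 - t) ^ (-p - q))) =
      ENNReal.ofReal (beta q p) * ENNReal.ofReal ((1 - s) ^ (-q) * s ^ (p + q - 1)) := by
  have hs0 := hs.1
  have hs1 : 0 < 1 - s := by linarith [hs.2]
  have hD : ∀ v ∈ Ioo (0 : ℝ) 1, 0 < 1 - s + s * v := fun v hv => by
    have := mul_pos hs0 hv.1
    linarith
  have hinv : ∀ v ∈ Ioo (0 : ℝ) 1,
      (s * v / (1 - s + s * v)) * (1 - s) / (s * (1 - s * v / (1 - s + s * v))) = v := by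
    intro v hv
    have h1 := (hD v hv).ne'
    have h2 : 1 - s * v / (1 - s + s * v) = (1 - s) / (1 - s + s * v) := by
      field_simp; ring
    rw [h2]
    field_simp
  have himg : (fun v : ℝ => s * v / (1 - s + s * v)) '' Ioo 0 1 = Ioo 0 s := by
    ext t
    constructor
    · rintro ⟨v, hv, rfl⟩
      refine ⟨div_pos (mul_pos hs0 hv.1) (hD v hv), ?_⟩
      simp only
      rw [div_lt_iff₀ (hD v hv)]
      have : 0 < s * ((1 - s) * (1 - v)) := mul_pos hs0 (mul_pos hs1 (by linarith [hv.2]))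
      linarith
    · intro ht
      have ht1 : 0 < 1 - t := by linarith [ht.2]
      refine ⟨t * (1 - s) / (s * (1 - t)), ⟨div_pos (mul_pos ht.1 hs1) (mul_pos hs0 ht1), ?_⟩, ?_⟩
      · rw [div_lt_one (mul_pos hs0 ht1)]; linarith [ht.2]
      · have h3 : 1 - s + s * (t * (1 - s) / (s * (1 - t))) = (1 - s) / (1 - t) := by
          field_simp; ring
        simp only
        rw [h3]
        field_simp
  rw [← himg, lintegral_image_eq_lintegral_abs_deriv_mul measurableSet_Ioo
    (f' := fun v => s * (1 - s) / (1 - s + s * v) ^ 2)]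
  · rw [mul_comm (ENNReal.ofReal (beta q p)), ← lintegral_beta hq hp,
      ← lintegral_const_mul _ (by fun_prop)]
    refine setLIntegral_congr_fun measurableSet_Ioo fun v hv => ?_
    have hv1 : 0 < 1 - v := by linarith [hv.2]
    have hv0 := hv.1
    have hDv := hD v hv
    rw [← ENNReal.ofReal_mul (by positivity), ← ENNReal.ofReal_mul (by positivity),
      abs_of_pos (by positivity)]
    congr 1
    generalize hDd : 1 - s + s * v = D at hDv
    have e1 : s - s * v / D = s * (1 - s) * (1 - v) / D := by
      field_simp; rw [← hDd]; ring
    have e2 : 1 - s * v / D = (1 - s) / D := by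
      field_simp; rw [← hDd]; ring
    rw [e1, e2, Real.div_rpow (by positivity) hDv.le, Real.div_rpow (by positivity) hDv.le,
      Real.div_rpow (by positivity) hDv.le, Real.mul_rpow (by positivity) hv1.le,
      Real.mul_rpow hs0.le hs1.le, Real.mul_rpow hs0.le hv0.le]
    have hD3 : D ^ (p - 1) * D ^ (q - 1) * D ^ (-p - q) * D ^ (2 : ℕ) = 1 := by
      rw [← Real.rpow_natCast, ← Real.rpow_add hDv, ← Real.rpow_add hDv, ← Real.rpow_add hDv]
      rw [show p - 1 + (q - 1) + (-p - q) + ((2 : ℕ) : ℝ) = 0 by push_cast; ring, Real.rpow_zero]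
    have hs3 : s ^ (p - 1) * s ^ (q - 1) * s = s ^ (p + q - 1) := by
      rw [← Real.rpow_add hs0, ← Real.rpow_add_one hs0.ne']
      congr 1; ring
    have hs4 : (1 - s) ^ (p - 1) * (1 - s) ^ (-p - q) * (1 - s) = (1 - s) ^ (-q) := by
      rw [← Real.rpow_add hs1, ← Real.rpow_add_one hs1.ne']
      congr 1; ring
    rw [← hs3, ← hs4]
    have hne : D ^ (p - 1) * D ^ (q - 1) * D ^ (-p - q) * D ^ (2 : ℕ) ≠ 0 := by rw [hD3]; simp
    calc _ = (1 - s) ^ (p - 1) * (1 - s) ^ (-p - q) * (1 - s) *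
          (s ^ (p - 1) * s ^ (q - 1) * s) * (v ^ (q - 1) * (1 - v) ^ (p - 1)) /
            (D ^ (p - 1) * D ^ (q - 1) * D ^ (-p - q) * D ^ (2 : ℕ)) := by
          field_simp
      _ = _ := by rw [hD3, div_one]
  · intro v hv
    have h1 := (hD v hv).ne'
    have hn : HasDerivAt (fun v : ℝ => s * v) s v := by
      simpa using (hasDerivAt_id v).const_mul s
    have := hn.div (hn.const_add (1 - s)) h1
    refine (this.congr_deriv ?_).hasDerivWithinAt
    congr 1; ring
  · intro v hv w hw h
    simp only at h
    rw [← hinv v hv, ← hinv w hw, h]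

lemma lintegral_triangle_swap {x : ℝ} {F : ℝ → ℝ → ℝ≥0∞}
    (hF : Measurable (Function.uncurry F)) :
    ∫⁻ s in Ioo 0 x, ∫⁻ t in Ioo 0 s, F s t = ∫⁻ t in Ioo 0 x, ∫⁻ s in Ioo t x, F s t := by
  have hT : MeasurableSet {p : ℝ × ℝ | p.2 < p.1} := measurableSet_lt measurable_snd measurable_fst
  have h1 : ∫⁻ s in Ioo 0 x, ∫⁻ t in Ioo 0 s, F s t =
      ∫⁻ s in Ioo 0 x, ∫⁻ t in Ioo 0 x,
        ({p : ℝ × ℝ | p.2 < p.1}.indicator (Function.uncurry F)) (s, t) := by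
    refine setLIntegral_congr_fun measurableSet_Ioo fun s hs => ?_
    have : Ioo 0 s = Iio s ∩ Ioo 0 x := by
      ext t; simp only [mem_Ioo, mem_inter_iff, mem_Iio]
      constructor
      · rintro ⟨h1, h2⟩; exact ⟨h2, h1, h2.trans hs.2⟩
      · rintro ⟨h1, h2, _⟩; exact ⟨h2, h1⟩
    rw [this, ← Measure.restrict_restrict measurableSet_Iio, ← lintegral_indicator measurableSet_Iio]
    rfl
  have h2 : ∫⁻ t in Ioo 0 x, ∫⁻ s in Ioo t x, F s t =
      ∫⁻ t in Ioo 0 x, ∫⁻ s in Ioo 0 x,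
        ({p : ℝ × ℝ | p.2 < p.1}.indicator (Function.uncurry F)) (s, t) := by
    refine setLIntegral_congr_fun measurableSet_Ioo fun t ht => ?_
    have : Ioo t x = Ioi t ∩ Ioo 0 x := by
      ext s; simp only [mem_Ioo, mem_inter_iff, mem_Ioi]
      constructor
      · rintro ⟨h1, h2⟩; exact ⟨h1, ht.1.trans h1, h2⟩
      · rintro ⟨h1, _, h2⟩; exact ⟨h1, h2⟩
    rw [this, ← Measure.restrict_restrict measurableSet_Ioi, ← lintegral_indicator measurableSet_Ioi]
    rfl
  rw [h1, h2, lintegral_lintegral_swap]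
  exact (hF.indicator hT).aemeasurable

/-- By `lintegral_beta_moebius` with p = α-1 and q = 1-γ, the weight ρ^{(γ-1,β-1)} is a multiple of
the fractional integral of order α-1 of ρ^{(-β,-γ)}. Orders 2-α and α-1 add up to one: after Tonelli
the integral in s is a beta integral independent of t and x, and a plain integral over (0,x)
remains. -/
lemma lintegral_left_power {α β γ x : ℝ} (hα₁ : 1 < α) (hα₂ : α < 2) (hγ : γ < 1)
    (hαβ : α = β + γ) (hx : x ∈ Ioo (0 : ℝ) 1) :
    ∫⁻ s in Ioo 0 x, ENNReal.ofReal ((x - s) ^ (1 - α) * rho (γ - 1) (β - 1) s) =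
      ENNReal.ofReal (beta (α - 1) (2 - α) / beta (1 - γ) (α - 1)) *
        ∫⁻ t in Ioo 0 x, ENNReal.ofReal (rho (-β) (-γ) t) := by
  have hB : 0 < beta (1 - γ) (α - 1) := beta_pos (by linarith) (by linarith)
  have hF : Measurable (Function.uncurry fun s t : ℝ =>
      ENNReal.ofReal ((x - s) ^ (1 - α) * ((s - t) ^ (α - 2) * rho (-β) (-γ) t))) := by
    unfold rho Function.uncurry
    fun_prop
  have h1 : ENNReal.ofReal (beta (1 - γ) (α - 1)) *
      ∫⁻ s in Ioo 0 x, ENNReal.ofReal ((x - s) ^ (1 - α) * rho (γ - 1) (β - 1) s) =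
      ∫⁻ s in Ioo 0 x, ∫⁻ t in Ioo 0 s,
        ENNReal.ofReal ((x - s) ^ (1 - α) * ((s - t) ^ (α - 2) * rho (-β) (-γ) t)) := by
    rw [← lintegral_const_mul _ (by unfold rho; fun_prop)]
    refine setLIntegral_congr_fun measurableSet_Ioo fun s hs => ?_
    have hs' : s ∈ Ioo (0 : ℝ) 1 := ⟨hs.1, hs.2.trans hx.2⟩
    have hxs : 0 ≤ x - s := by linarith [hs.2]
    have hm := lintegral_beta_moebius hs' (p := α - 1) (q := 1 - γ) (by linarith) (by linarith)
    simp_rw [ENNReal.ofReal_mul (Real.rpow_nonneg hxs _)]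
    rw [lintegral_const_mul _ (by unfold rho; fun_prop)]
    have e1 : rho (γ - 1) (β - 1) s = (1 - s) ^ (-(1 - γ)) * s ^ (α - 1 + (1 - γ) - 1) := by
      rw [rho, hαβ]; congr 2 <;> ring
    rw [e1, mul_left_comm, ← hm]
    congr 1
    refine setLIntegral_congr_fun measurableSet_Ioo fun t _ => ?_
    simp only [rho, hαβ]
    rw [mul_comm ((1 - t) ^ (-β))]
    ring_nf
  have h2 : ∫⁻ s in Ioo 0 x, ∫⁻ t in Ioo 0 s,
        ENNReal.ofReal ((x - s) ^ (1 - α) * ((s - t) ^ (α - 2) * rho (-β) (-γ) t)) =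
      ENNReal.ofReal (beta (α - 1) (2 - α)) *
        ∫⁻ t in Ioo 0 x, ENNReal.ofReal (rho (-β) (-γ) t) := by
    rw [lintegral_triangle_swap hF, ← lintegral_const_mul _ (by unfold rho; fun_prop)]
    refine setLIntegral_congr_fun measurableSet_Ioo fun t ht => ?_
    have ht' : t ∈ Ioo (0 : ℝ) 1 := ⟨ht.1, ht.2.trans hx.2⟩
    have hm := lintegral_beta_interval ht.2 (p := 2 - α) (q := α - 1) (by linarith) (by linarith)
    rw [show 2 - α + (α - 1) - 1 = 0 by ring, Real.rpow_zero, mul_one] at hm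
    rw [← hm, ← lintegral_mul_const _ (by fun_prop)]
    refine setLIntegral_congr_fun measurableSet_Ioo fun s hs => ?_
    have hxs : 0 ≤ x - s := by linarith [hs.2]
    have hst : 0 ≤ s - t := by linarith [hs.1]
    rw [← ENNReal.ofReal_mul (by positivity), ← mul_assoc, show 2 - α - 1 = 1 - α by ring,
      show α - 1 - 1 = α - 2 by ring]
  have hB0 : ENNReal.ofReal (beta (1 - γ) (α - 1)) ≠ 0 := by simpa using hB
  rw [← ENNReal.mul_right_inj hB0 ENNReal.ofReal_ne_top, h1, h2, ← mul_assoc,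
    ← ENNReal.ofReal_mul hB.le, mul_div_cancel₀ _ hB.ne']

/-! ### The convolution kernel of the flux -/

/-- The truncated power `z^{1-α}` on `(0,1)`. -/
noncomputable def powKer (α : ℝ) : ℝ → ℝ := (Ioo (0 : ℝ) 1).indicator fun z => z ^ (1 - α)

/-- The convolution kernel of `Γ(2-α) (r ₀I_x^{2-α} + (1 - r) ₓI_1^{2-α})` on `(0,1)`. -/
noncomputable def fluxKer (α r z : ℝ) : ℝ := r * powKer α z + (1 - r) * powKer α (-z)

lemma measurable_powKer (α : ℝ) : Measurable (powKer α) :=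
  (by fun_prop : Measurable fun z : ℝ => z ^ (1 - α)).indicator measurableSet_Ioo

lemma measurable_fluxKer (α r : ℝ) : Measurable (fluxKer α r) :=
  ((measurable_powKer α).const_mul r).add
    (((measurable_powKer α).comp measurable_neg).const_mul (1 - r))

lemma powKer_nonneg (α z : ℝ) : 0 ≤ powKer α z :=
  indicator_nonneg (fun _ hz => Real.rpow_nonneg hz.1.le _) z

lemma fluxKer_nonneg {r : ℝ} (α : ℝ) (hr₀ : 0 ≤ r) (hr₁ : r ≤ 1) (z : ℝ) : 0 ≤ fluxKer α r z :=
  add_nonneg (mul_nonneg hr₀ (powKer_nonneg α z))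
    (mul_nonneg (by linarith) (powKer_nonneg α (-z)))

lemma fluxKer_neg (α r z : ℝ) : fluxKer α r (-z) = fluxKer α (1 - r) z := by
  simp only [fluxKer, neg_neg]; ring

lemma fluxKer_of_lt {α r x s : ℝ} (hs : 0 < s) (hx : x < 1) (h : s < x) :
    fluxKer α r (x - s) = r * (x - s) ^ (1 - α) := by
  rw [fluxKer, powKer, indicator_of_mem, indicator_of_notMem, mul_zero, add_zero]
  · rintro ⟨h1, _⟩; linarith
  · constructor <;> linarith

lemma fluxKer_of_gt {α r x s : ℝ} (hx : 0 < x) (hs : s < 1) (h : x < s) :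
    fluxKer α r (x - s) = (1 - r) * (s - x) ^ (1 - α) := by
  rw [fluxKer, powKer, indicator_of_notMem, indicator_of_mem, mul_zero, zero_add, neg_sub]
  · constructor <;> linarith
  · rintro ⟨h1, _⟩; linarith

lemma lintegral_Ioo_split {x : ℝ} (hx : x ∈ Ioo (0 : ℝ) 1) (g : ℝ → ℝ≥0∞) :
    ∫⁻ s in Ioo 0 1, g s = (∫⁻ s in Ioo 0 x, g s) + ∫⁻ s in Ioo x 1, g s := by
  rw [← Ioc_union_Ioo_eq_Ioo hx.1.le hx.2, lintegral_union measurableSet_Ioo]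
  · rw [setLIntegral_congr (Ioo_ae_eq_Ioc (a := 0) (b := x))]
  · rw [Set.disjoint_left]
    intro y hy hy'
    exact absurd hy.2 (not_le.mpr hy'.1)

lemma lintegral_fluxKer_split {α r x : ℝ} (a b : ℝ) (hr₀ : 0 ≤ r) (hr₁ : r ≤ 1)
    (hx : x ∈ Ioo (0 : ℝ) 1) :
    ∫⁻ s in Ioo 0 1, ENNReal.ofReal (fluxKer α r (x - s) * rho a b s) =
      ENNReal.ofReal r * (∫⁻ s in Ioo 0 x, ENNReal.ofReal ((x - s) ^ (1 - α) * rho a b s)) +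
      ENNReal.ofReal (1 - r) *
        ∫⁻ s in Ioo x 1, ENNReal.ofReal ((s - x) ^ (1 - α) * rho a b s) := by
  rw [lintegral_Ioo_split hx]
  congr 1
  · rw [← lintegral_const_mul _ (by unfold rho; fun_prop)]
    refine setLIntegral_congr_fun measurableSet_Ioo fun s hs => ?_
    rw [fluxKer_of_lt hs.1 hx.2 hs.2, mul_assoc, ENNReal.ofReal_mul hr₀]
  · rw [← lintegral_const_mul _ (by unfold rho; fun_prop)]
    refine setLIntegral_congr_fun measurableSet_Ioo fun s hs => ?_
    rw [fluxKer_of_gt hx.1 hs.2 hs.1, mul_assoc, ENNReal.ofReal_mul (by linarith)]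

lemma lintegral_fluxKer_reflect (α r x a b : ℝ) :
    ∫⁻ s in Ioo 0 1, ENNReal.ofReal (fluxKer α r (x - s) * rho a b s) =
      ∫⁻ s in Ioo 0 1, ENNReal.ofReal (fluxKer α (1 - r) (1 - x - s) * rho b a s) := by
  have h := lintegral_Ioo_one_sub 0 1
    fun s => ENNReal.ofReal (fluxKer α r (x - s) * rho a b s)
  simp only [sub_self, sub_zero] at h
  rw [← h]
  refine lintegral_congr fun s => ?_
  rw [rho_one_sub, ← fluxKer_neg]
  congr 3; ring

/-! ### Admissible parameters and the constant flux of the kernel function -/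

/-- The admissible parameters, with `γ = α - β`. -/
structure Admissible (α β γ r : ℝ) : Prop where
  one_lt : 1 < α
  lt_two : α < 2
  eq_add : α = β + γ
  β_pos : 0 < β
  β_le : β ≤ 1
  γ_pos : 0 < γ
  γ_le : γ ≤ 1
  r_eq : r = Real.sin (Real.pi * β) / (Real.sin (Real.pi * γ) + Real.sin (Real.pi * β))

namespace Admissible

variable {α β γ r : ℝ}

lemma sin_β_nonneg (h : Admissible α β γ r) : 0 ≤ Real.sin (Real.pi * β) :=
  Real.sin_nonneg_of_nonneg_of_le_pi (mul_nonneg Real.pi_pos.le h.β_pos.le)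
    (mul_le_of_le_one_right Real.pi_pos.le h.β_le)

lemma sin_γ_nonneg (h : Admissible α β γ r) : 0 ≤ Real.sin (Real.pi * γ) :=
  Real.sin_nonneg_of_nonneg_of_le_pi (mul_nonneg Real.pi_pos.le h.γ_pos.le)
    (mul_le_of_le_one_right Real.pi_pos.le h.γ_le)

lemma sin_pos {u : ℝ} (h₀ : 0 < u) (h₁ : u < 1) : 0 < Real.sin (Real.pi * u) :=
  Real.sin_pos_of_pos_of_lt_pi (mul_pos Real.pi_pos h₀) (mul_lt_of_lt_one_right Real.pi_pos h₁)

/-- Since β + γ = α < 2, at most one of β and γ equals 1, so at most one of the two sines vanishes.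
-/
lemma S_pos (h : Admissible α β γ r) : 0 < Real.sin (Real.pi * γ) + Real.sin (Real.pi * β) := by
  have h1 := h.lt_two
  have h2 := h.eq_add
  rcases h.β_le.lt_or_eq with hb | hb
  · exact add_pos_of_nonneg_of_pos h.sin_γ_nonneg (sin_pos h.β_pos hb)
  · exact add_pos_of_pos_of_nonneg (sin_pos h.γ_pos (by linarith)) h.sin_β_nonneg

lemma one_sub_r (h : Admissible α β γ r) :
    1 - r = Real.sin (Real.pi * γ) / (Real.sin (Real.pi * β) + Real.sin (Real.pi * γ)) := by
  rw [h.r_eq, add_comm (Real.sin (Real.pi * β)), eq_div_iff h.S_pos.ne', sub_mul,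
    div_mul_cancel₀ _ h.S_pos.ne']
  ring

/-- The reflection x ↦ 1-x exchanges left with right, β with γ and r with 1-r. It halves the work
below and identifies the adjoint problem as one of the same kind. -/
lemma swap (h : Admissible α β γ r) : Admissible α γ β (1 - r) :=
  ⟨h.one_lt, h.lt_two, by rw [h.eq_add, add_comm], h.γ_pos, h.γ_le, h.β_pos, h.β_le, h.one_sub_r⟩

lemma r_nonneg (h : Admissible α β γ r) : 0 ≤ r := by
  rw [h.r_eq]; exact div_nonneg h.sin_β_nonneg h.S_pos.le

lemma r_le_one (h : Admissible α β γ r) : r ≤ 1 := by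
  have := h.swap.r_nonneg
  linarith

/-- The Möbius representation breaks down at γ = 1, but there sin(πγ) = 0 forces r = 1. Only the
left integral survives, and it is a beta integral in which the exponent of x is zero. -/
lemma lintegral_of_γ_eq_one (h : Admissible α β γ r) (hγ : γ = 1) {x : ℝ}
    (hx : x ∈ Ioo (0 : ℝ) 1) :
    ∫⁻ s in Ioo 0 1, ENNReal.ofReal (fluxKer α r (x - s) * rho (γ - 1) (β - 1) s) =
      ENNReal.ofReal (Real.pi / (Real.sin (Real.pi * γ) + Real.sin (Real.pi * β))) := by
  have hα := h.eq_add
  have hβ : β < 1 := by linarith [h.lt_two]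
  have hsin : Real.sin (Real.pi * γ) = 0 := by simp [hγ]
  have hr : r = 1 := by
    rw [h.r_eq, hsin, zero_add, div_self (sin_pos h.β_pos hβ).ne']
  rw [lintegral_fluxKer_split _ _ h.r_nonneg h.r_le_one hx, hr]
  have hb := lintegral_beta_interval hx.1 (p := 1 - β) (q := β) (by linarith) h.β_pos
  simp only [sub_self, ENNReal.ofReal_zero, zero_mul, add_zero, ENNReal.ofReal_one, one_mul]
  rw [hsin, zero_add, ← Real.Gamma_mul_Gamma_one_sub]
  have hB : beta β (1 - β) * (x - 0) ^ (1 - β + β - 1) = Real.Gamma β * Real.Gamma (1 - β) := by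
    simp [beta]
  rw [← hB, ← hb]
  refine setLIntegral_congr_fun measurableSet_Ioo fun s _ => ?_
  simp only [rho, hγ, hα, sub_self, Real.rpow_zero, one_mul, sub_zero]
  congr 3; ring

/-- The left and right integrals are multiples of the integrals of ρ^{(-β,-γ)} over (0,x) and (x,1).
The weights r and 1-r make the two multiples equal, so the sum is a beta integral over all of (0,1)
and x disappears. -/
lemma lintegral_of_lt_one (h : Admissible α β γ r) (hβ : β < 1) (hγ : γ < 1) {x : ℝ}
    (hx : x ∈ Ioo (0 : ℝ) 1) :
    ∫⁻ s in Ioo 0 1, ENNReal.ofReal (fluxKer α r (x - s) * rho (γ - 1) (β - 1) s) =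
      ENNReal.ofReal (Real.pi / (Real.sin (Real.pi * γ) + Real.sin (Real.pi * β))) := by
  have hα := h.eq_add
  have h₁ := h.one_lt
  have h₂ := h.lt_two
  have hx' : 1 - x ∈ Ioo (0 : ℝ) 1 := ⟨by linarith [hx.2], by linarith [hx.1]⟩
  have hR : ∫⁻ s in Ioo x 1, ENNReal.ofReal ((s - x) ^ (1 - α) * rho (γ - 1) (β - 1) s) =
      ENNReal.ofReal (beta (α - 1) (2 - α) / beta (1 - β) (α - 1)) *
        ∫⁻ t in Ioo x 1, ENNReal.ofReal (rho (-β) (-γ) t) := by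
    have hl := lintegral_left_power h₁ h₂ hβ (by rw [hα, add_comm] : α = γ + β) hx'
    have e1 := lintegral_Ioo_one_sub 0 (1 - x)
      fun s => ENNReal.ofReal ((s - x) ^ (1 - α) * rho (γ - 1) (β - 1) s)
    have e2 := lintegral_Ioo_one_sub 0 (1 - x) fun s => ENNReal.ofReal (rho (-β) (-γ) s)
    simp only [sub_sub_cancel, sub_zero, rho_one_sub] at e1 e2
    rw [← e1, ← e2, ← hl]
    refine lintegral_congr fun s => ?_
    congr 3; ring
  rw [lintegral_fluxKer_split _ _ h.r_nonneg h.r_le_one hx, hR, lintegral_left_power h₁ h₂ hγ hα hx,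
    ← mul_assoc, ← mul_assoc, ← ENNReal.ofReal_mul h.r_nonneg,
    ← ENNReal.ofReal_mul h.swap.r_nonneg]
  have g1 : 0 < Real.Gamma β := Real.Gamma_pos_of_pos h.β_pos
  have g2 : 0 < Real.Gamma γ := Real.Gamma_pos_of_pos h.γ_pos
  have g3 : 0 < Real.Gamma (1 - β) := Real.Gamma_pos_of_pos (by linarith)
  have g4 : 0 < Real.Gamma (1 - γ) := Real.Gamma_pos_of_pos (by linarith)
  have g5 : 0 < Real.Gamma (α - 1) := Real.Gamma_pos_of_pos (by linarith)
  have g6 : 0 < Real.Gamma (2 - α) := Real.Gamma_pos_of_pos (by linarith)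
  have s1 := sin_pos h.β_pos hβ
  have s2 := sin_pos h.γ_pos hγ
  have r1 : Real.sin (Real.pi * β) * (Real.Gamma β * Real.Gamma (1 - β)) = Real.pi := by
    rw [Real.Gamma_mul_Gamma_one_sub]; field_simp
  have r2 : Real.sin (Real.pi * γ) * (Real.Gamma γ * Real.Gamma (1 - γ)) = Real.pi := by
    rw [Real.Gamma_mul_Gamma_one_sub]; field_simp
  have hS := h.S_pos
  set S := Real.sin (Real.pi * γ) + Real.sin (Real.pi * β) with hSd
  -- The reflection formula trades the sine in the numerator of r for Gamma values; the result is
  -- symmetric in β and γ and hence agrees with `k2`.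
  have k1 : r * (beta (α - 1) (2 - α) / beta (1 - γ) (α - 1)) =
      Real.pi / S * (Real.Gamma (2 - α) / (Real.Gamma (1 - γ) * Real.Gamma (1 - β))) := by
    rw [h.r_eq, ← hSd, beta, beta, show α - 1 + (2 - α) = 1 by ring, Real.Gamma_one,
      show 1 - γ + (α - 1) = β by rw [hα]; ring,
      show Real.pi / S = Real.sin (Real.pi * β) * (Real.Gamma β * Real.Gamma (1 - β)) / S by rw [r1]]
    field_simp
  have k2 : (1 - r) * (beta (α - 1) (2 - α) / beta (1 - β) (α - 1)) =
      Real.pi / S * (Real.Gamma (2 - α) / (Real.Gamma (1 - γ) * Real.Gamma (1 - β))) := by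
    rw [h.one_sub_r, add_comm (Real.sin (Real.pi * β)), ← hSd, beta, beta,
      show α - 1 + (2 - α) = 1 by ring, Real.Gamma_one,
      show 1 - β + (α - 1) = γ by rw [hα]; ring,
      show Real.pi / S = Real.sin (Real.pi * γ) * (Real.Gamma γ * Real.Gamma (1 - γ)) / S by rw [r2]]
    field_simp
  rw [k1, k2, ← mul_add, ← lintegral_Ioo_split hx]
  have hb := lintegral_beta (p := 1 - γ) (q := 1 - β) (by linarith) (by linarith)
  have hb' : ∫⁻ t in Ioo 0 1, ENNReal.ofReal (rho (-β) (-γ) t) =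
      ENNReal.ofReal (beta (1 - γ) (1 - β)) := by
    rw [← hb]
    refine lintegral_congr fun t => ?_
    rw [rho, mul_comm]
    congr 3 <;> ring
  rw [hb', ← ENNReal.ofReal_mul (by positivity), beta,
    show 1 - γ + (1 - β) = 2 - α by rw [hα]; ring]
  congr 1
  field_simp

/-- `k` is mapped to a constant. -/
lemma lintegral_fluxKer (h : Admissible α β γ r) {x : ℝ} (hx : x ∈ Ioo (0 : ℝ) 1) :
    ∫⁻ s in Ioo 0 1, ENNReal.ofReal (fluxKer α r (x - s) * rho (γ - 1) (β - 1) s) =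
      ENNReal.ofReal (Real.pi / (Real.sin (Real.pi * γ) + Real.sin (Real.pi * β))) := by
  rcases h.γ_le.lt_or_eq with hγ | hγ
  · rcases h.β_le.lt_or_eq with hβ | hβ
    · exact h.lintegral_of_lt_one hβ hγ hx
    · rw [lintegral_fluxKer_reflect, add_comm]
      exact h.swap.lintegral_of_γ_eq_one hβ ⟨by linarith [hx.2], by linarith [hx.1]⟩
  · exact h.lintegral_of_γ_eq_one hγ hx

end Admissible

/-! ### The flux operator and the primitive of its kernel -/

/-- `Γ(2-α) (r ₀I_x^{2-α} + (1 - r) ₓI_1^{2-α}) w` as a single integral. -/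
noncomputable def fluxOp (α r : ℝ) (w : ℝ → ℝ) (x : ℝ) : ℝ :=
  ∫ s in Ioo (0 : ℝ) 1, fluxKer α r (x - s) * w s

/-- The cut-off at 1 gives integrability on the whole line, so general convolution results apply; it
is invisible to x, s in (0,1), where |x-s| < 1. -/
lemma integrable_powKer {α : ℝ} (hα : α < 2) : Integrable (powKer α) := by
  unfold powKer
  rw [integrable_indicator_iff measurableSet_Ioo,
    ← intervalIntegrable_iff_integrableOn_Ioo_of_le zero_le_one]
  exact intervalIntegral.intervalIntegrable_rpow' (by linarith)

lemma integrable_fluxKer {α : ℝ} (hα : α < 2) (r : ℝ) : Integrable (fluxKer α r) :=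
  ((integrable_powKer hα).const_mul r).add ((integrable_powKer hα).comp_neg.const_mul (1 - r))

lemma integrable_prod_comp_sub_mul {g w : ℝ → ℝ} (hg : Integrable g)
    (hw : IntegrableOn w (Ioo 0 1)) (A : Set ℝ) :
    Integrable (fun p : ℝ × ℝ => g (p.1 - p.2) * w p.2)
      ((volume.restrict A).prod (volume.restrict (Ioo (0 : ℝ) 1))) := by
  have h := Integrable.convolution_integrand (ContinuousLinearMap.mul ℝ ℝ) hw.integrable hg
  have h2 : (volume.restrict A).prod (volume.restrict (Ioo (0 : ℝ) 1)) =
      (volume.prod (volume.restrict (Ioo (0 : ℝ) 1))).restrict (A ×ˢ univ) := by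
    rw [← Measure.prod_restrict, Measure.restrict_univ]
  rw [h2]
  refine Integrable.restrict ?_
  simpa [mul_comm] using h

/-- The primitive of `(2 - α) fluxKer α r` on `(-1,1)`. -/
noncomputable def fluxPrim (α r z : ℝ) : ℝ :=
  r * (max z 0) ^ (2 - α) - (1 - r) * (max (-z) 0) ^ (2 - α)

lemma continuous_fluxPrim {α : ℝ} (hα : α < 2) (r : ℝ) : Continuous (fluxPrim α r) := by
  unfold fluxPrim
  refine (continuous_const.mul ?_).sub (continuous_const.mul ?_)
  · exact (continuous_id.max continuous_const).rpow_const fun _ => Or.inr (by linarith)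
  · exact (continuous_neg.max continuous_const).rpow_const fun _ => Or.inr (by linarith)

lemma powKer_of_neg {α z : ℝ} (hz : z ≤ 0) : powKer α z = 0 :=
  indicator_of_notMem (fun h => absurd h.1 (not_lt.mpr hz)) _

lemma powKer_of_mem {α z : ℝ} (hz : z ∈ Ioo (0 : ℝ) 1) : powKer α z = z ^ (1 - α) :=
  indicator_of_mem hz _

/-- Homogeneity of degree 1-α: z times the kernel is, up to the factor 2-α, its primitive. This is
what makes `fluxOp` interact well with multiplication by x. -/
lemma mul_fluxKer {α : ℝ} (hα : α < 2) (r : ℝ) {z : ℝ} (hz : z ∈ Ioo (-1 : ℝ) 1) :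
    z * fluxKer α r z = fluxPrim α r z := by
  have h0 : (2 - α) ≠ 0 := by linarith
  unfold fluxKer fluxPrim
  rcases lt_trichotomy z 0 with h | h | h
  · rw [powKer_of_neg h.le, powKer_of_mem ⟨by linarith, by linarith [hz.1]⟩, max_eq_right h.le,
      max_eq_left (by linarith), Real.zero_rpow h0, show 2 - α = 1 - α + 1 by ring,
      Real.rpow_add_one (by linarith)]
    ring
  · simp [h, Real.zero_rpow h0]
  · rw [powKer_of_mem ⟨h, hz.2⟩, powKer_of_neg (by linarith), max_eq_left h.le,
      max_eq_right (by linarith), Real.zero_rpow h0, show 2 - α = 1 - α + 1 by ring,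
      Real.rpow_add_one h.ne']
    ring

lemma hasDerivAt_fluxPrim {α : ℝ} (hα : α < 2) (r : ℝ) {z : ℝ} (hz : z ∈ Ioo (-1 : ℝ) 1)
    (hz0 : z ≠ 0) : HasDerivAt (fluxPrim α r) ((2 - α) * fluxKer α r z) z := by
  have h0 : (2 - α) ≠ 0 := by linarith
  rcases lt_or_gt_of_ne hz0 with h | h
  · have hd : HasDerivAt (fun y : ℝ => -((1 - r) * (-y) ^ (2 - α)))
        ((2 - α) * fluxKer α r z) z := by
      have := (((hasDerivAt_id z).neg.rpow_const (p := 2 - α)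
        (Or.inl (by simpa using hz0))).const_mul (1 - r)).neg
      refine this.congr_deriv ?_
      rw [fluxKer, powKer_of_neg h.le, powKer_of_mem ⟨by linarith, by linarith [hz.1]⟩]
      simp only [Pi.neg_apply, id]
      rw [show 2 - α - 1 = 1 - α by ring]
      ring
    refine hd.congr_of_eventuallyEq ?_
    filter_upwards [Iio_mem_nhds h] with y hy
    rw [fluxPrim, max_eq_right (le_of_lt hy), max_eq_left (by linarith [mem_Iio.mp hy]),
      Real.zero_rpow h0]
    ring
  · have hd : HasDerivAt (fun y : ℝ => r * y ^ (2 - α)) ((2 - α) * fluxKer α r z) z := by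
      have := (Real.hasDerivAt_rpow_const (x := z) (p := 2 - α) (Or.inl hz0)).const_mul r
      refine this.congr_deriv ?_
      rw [fluxKer, powKer_of_mem ⟨h, hz.2⟩, powKer_of_neg (by linarith),
        show 2 - α - 1 = 1 - α by ring]
      ring
    refine hd.congr_of_eventuallyEq ?_
    filter_upwards [Ioi_mem_nhds h] with y hy
    rw [fluxPrim, max_eq_left (le_of_lt hy), max_eq_right (by linarith [mem_Ioi.mp hy]),
      Real.zero_rpow h0]
    ring

lemma fluxPrim_sub {α : ℝ} (hα : α < 2) (r : ℝ) {x s : ℝ} (hx : x ∈ Ioo (0 : ℝ) 1)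
    (hs : s ∈ Ioo (0 : ℝ) 1) :
    (2 - α) * ∫ t in Ioo 0 x, fluxKer α r (t - s) = fluxPrim α r (x - s) - fluxPrim α r (-s) := by
  rw [← integral_Ioc_eq_integral_Ioo, ← intervalIntegral.integral_of_le hx.1.le,
    ← intervalIntegral.integral_const_mul,
    integral_eq_of_hasDerivAt_off_countable_of_le (fun t => fluxPrim α r (t - s)) _ hx.1.le
      (countable_singleton s)]
  · simp
  · exact ((continuous_fluxPrim hα r).comp (continuous_id.sub continuous_const)).continuousOn
  · rintro t ⟨ht, hts⟩
    have := (hasDerivAt_fluxPrim hα r (z := t - s)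
      ⟨by linarith [ht.1, hs.2], by linarith [ht.2, hs.1, hx.2]⟩ (sub_ne_zero.mpr hts)).comp t
      ((hasDerivAt_id t).sub_const s)
    rw [mul_one] at this
    exact this
  · exact (((integrable_fluxKer hα r).comp_sub_right s).const_mul _).intervalIntegrable

lemma integrableOn_fluxPrim_mul {α : ℝ} (hα : α < 2) (r x : ℝ) {w : ℝ → ℝ}
    (hw : IntegrableOn w (Ioo 0 1)) :
    IntegrableOn (fun s => fluxPrim α r (x - s) * w s) (Ioo 0 1) :=
  IntegrableOn.continuousOn_mul_of_subset
    ((continuous_fluxPrim hα r).comp (continuous_const.sub continuous_id)).continuousOn hw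
    isCompact_Icc measurableSet_Ioo Ioo_subset_Icc_self

lemma integral_fluxOp {α : ℝ} (hα : α < 2) (r : ℝ) {x : ℝ} (hx : x ∈ Ioo (0 : ℝ) 1) {w : ℝ → ℝ}
    (hw : IntegrableOn w (Ioo 0 1)) :
    (2 - α) * ∫ t in 0..x, fluxOp α r w t =
      (∫ s in Ioo (0 : ℝ) 1, fluxPrim α r (x - s) * w s) -
        ∫ s in Ioo (0 : ℝ) 1, fluxPrim α r (0 - s) * w s := by
  rw [← integral_sub (integrableOn_fluxPrim_mul hα r x hw).integrable
    (integrableOn_fluxPrim_mul hα r 0 hw).integrable, intervalIntegral.integral_of_le hx.1.le,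
    integral_Ioc_eq_integral_Ioo]
  unfold fluxOp
  rw [integral_integral_swap (integrable_prod_comp_sub_mul (integrable_fluxKer hα r) hw _),
    ← integral_const_mul]
  refine setIntegral_congr_fun measurableSet_Ioo fun s hs => ?_
  rw [integral_mul_const, ← mul_assoc, fluxPrim_sub hα r hx hs, zero_sub, sub_mul]

lemma sub_mem_Ioo {x s : ℝ} (hx : x ∈ Ioo (0 : ℝ) 1) (hs : s ∈ Ioo (0 : ℝ) 1) :
    x - s ∈ Ioo (-1 : ℝ) 1 := ⟨by linarith [hx.1, hs.2], by linarith [hx.2, hs.1]⟩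

/-- Write s = x - (x-s); the factor x-s turns the kernel into its primitive. -/
lemma fluxOp_id_mul {α : ℝ} (hα : α < 2) (r : ℝ) {x : ℝ} (hx : x ∈ Ioo (0 : ℝ) 1) {w : ℝ → ℝ}
    (hw : IntegrableOn w (Ioo 0 1))
    (hwx : IntegrableOn (fun s => fluxKer α r (x - s) * w s) (Ioo 0 1)) :
    fluxOp α r (fun s => s * w s) x =
      x * fluxOp α r w x - ∫ s in Ioo (0 : ℝ) 1, fluxPrim α r (x - s) * w s := by
  unfold fluxOp
  rw [← integral_const_mul, ← integral_sub (hwx.integrable.const_mul x)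
    (integrableOn_fluxPrim_mul hα r x hw).integrable]
  refine setIntegral_congr_fun measurableSet_Ioo fun s hs => ?_
  simp only
  rw [← mul_fluxKer hα r (sub_mem_Ioo hx hs)]
  ring

lemma exists_derivative_eq (Q : ℝ[X]) {n : ℕ} (hQ : Q.natDegree ≤ n) :
    ∃ R : ℝ[X], derivative R = Q ∧ R.natDegree ≤ n + 1 := by
  refine ⟨∑ i ∈ Finset.range (n + 1), monomial (i + 1) (Q.coeff i / ((i : ℝ) + 1)), ?_, ?_⟩
  · rw [derivative_sum]
    conv_rhs => rw [Q.as_sum_range' (n + 1) (Nat.lt_succ_of_le hQ)]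
    refine Finset.sum_congr rfl fun i _ => ?_
    rw [derivative_monomial]
    congr 1
    have : (i : ℝ) + 1 ≠ 0 := by positivity
    push_cast
    field_simp
  · refine natDegree_sum_le_of_forall_le _ _ fun i hi => (natDegree_monomial_le _).trans ?_
    have := Finset.mem_range.mp hi
    omega

lemma integral_eval_derivative (R : ℝ[X]) (x : ℝ) :
    ∫ t in 0..x, (derivative R).eval t = R.eval x - R.eval 0 :=
  intervalIntegral.integral_eq_sub_of_hasDerivAt (fun t _ => R.hasDerivAt t)
    ((derivative R).continuous.intervalIntegrable _ _)

/-- If `fluxOp w` is a polynomial, then `∫ fluxPrim (x - s) w(s) ds` is a primitive of it. -/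
lemma integral_fluxPrim_eq_eval {α : ℝ} (hα : α < 2) (r : ℝ) {w : ℝ → ℝ}
    (hw : IntegrableOn w (Ioo 0 1)) {R : ℝ[X]}
    (hR : ∀ x ∈ Ioo (0 : ℝ) 1, fluxOp α r w x = (derivative R).eval x) :
    ∃ c : ℝ, ∀ x ∈ Ioo (0 : ℝ) 1,
      ∫ s in Ioo (0 : ℝ) 1, fluxPrim α r (x - s) * w s = (2 - α) * R.eval x + c := by
  refine ⟨(∫ s in Ioo (0 : ℝ) 1, fluxPrim α r (0 - s) * w s) - (2 - α) * R.eval 0, fun x hx => ?_⟩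
  have h := integral_fluxOp hα r hx hw
  have h2 : ∫ t in 0..x, fluxOp α r w t = ∫ t in 0..x, (derivative R).eval t := by
    rw [intervalIntegral.integral_of_le hx.1.le, intervalIntegral.integral_of_le hx.1.le,
      integral_Ioc_eq_integral_Ioo, integral_Ioc_eq_integral_Ioo]
    exact setIntegral_congr_fun measurableSet_Ioo fun t ht => hR t ⟨ht.1, ht.2.trans hx.2⟩
  rw [h2, integral_eval_derivative] at h
  linarith

/-! ### Diagonalisation in the Jacobi bases -/

/-- The diagonal coefficients of `fluxOp` between the two Jacobi bases. -/
noncomputable def fluxCoeff (α S : ℝ) (n : ℕ) : ℝ :=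
  Real.pi / S * ∏ j ∈ Finset.range n, ((j : ℝ) + α - 1) / ((j : ℝ) + 1)

namespace Admissible

variable {α β γ r : ℝ}

/-- The integrand is nonnegative and its Lebesgue integral has been computed, so integrability holds
at every x of (0,1), not merely almost everywhere. -/
lemma integrableOn_fluxKer_mul_rho (h : Admissible α β γ r) {x : ℝ} (hx : x ∈ Ioo (0 : ℝ) 1) :
    IntegrableOn (fun s => fluxKer α r (x - s) * rho (γ - 1) (β - 1) s) (Ioo 0 1) := by
  refine ⟨(((measurable_fluxKer α r).comp (measurable_const.sub measurable_id)).mul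
    (measurable_rho _ _)).aestronglyMeasurable, ?_⟩
  rw [hasFiniteIntegral_iff_ofReal, h.lintegral_fluxKer hx]
  · exact ENNReal.ofReal_lt_top
  · exact ae_restrict_of_forall_mem measurableSet_Ioo fun s hs =>
      mul_nonneg (fluxKer_nonneg α h.r_nonneg h.r_le_one _) (rho_pos _ _ hs).le

lemma fluxOp_rho (h : Admissible α β γ r) {x : ℝ} (hx : x ∈ Ioo (0 : ℝ) 1) :
    fluxOp α r (rho (γ - 1) (β - 1)) x =
      Real.pi / (Real.sin (Real.pi * γ) + Real.sin (Real.pi * β)) := by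
  rw [fluxOp, integral_eq_lintegral_of_nonneg_ae, h.lintegral_fluxKer hx, ENNReal.toReal_ofReal]
  · exact div_nonneg Real.pi_pos.le h.S_pos.le
  · exact ae_restrict_of_forall_mem measurableSet_Ioo fun s hs =>
      mul_nonneg (fluxKer_nonneg α h.r_nonneg h.r_le_one _) (rho_pos _ _ hs).le
  · exact (h.integrableOn_fluxKer_mul_rho hx).aestronglyMeasurable

lemma integrableOn_fluxKer_mul_rho_mul (h : Admissible α β γ r) {x : ℝ} (hx : x ∈ Ioo (0 : ℝ) 1)
    (P : ℝ[X]) :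
    IntegrableOn (fun s => fluxKer α r (x - s) * (rho (γ - 1) (β - 1) s * P.eval s))
      (Ioo 0 1) := by
  simp_rw [← mul_assoc]
  exact (h.integrableOn_fluxKer_mul_rho hx).mul_continuousOn_of_subset P.continuous.continuousOn
    measurableSet_Ioo isCompact_Icc Ioo_subset_Icc_self

lemma integrableOn_rho_mul_eval' (h : Admissible α β γ r) (P : ℝ[X]) :
    IntegrableOn (fun s => rho (γ - 1) (β - 1) s * P.eval s) (Ioo 0 1) :=
  integrableOn_rho_mul_eval (by linarith [h.γ_pos]) (by linarith [h.β_pos]) P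

/-- `fluxOp` maps `ρ^{(γ-1,β-1)} P` to a polynomial of at most the same degree. -/
theorem exists_fluxOp_eq_eval (h : Admissible α β γ r) (n : ℕ) : ∀ P : ℝ[X], P.natDegree ≤ n →
    ∃ Q : ℝ[X], Q.natDegree ≤ n ∧
      Q.coeff n = fluxCoeff α (Real.sin (Real.pi * γ) + Real.sin (Real.pi * β)) n * P.coeff n ∧
      ∀ x ∈ Ioo (0 : ℝ) 1,
        fluxOp α r (fun s => rho (γ - 1) (β - 1) s * P.eval s) x = Q.eval x := by
  set S := Real.sin (Real.pi * γ) + Real.sin (Real.pi * β) with hS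
  have hconst : ∀ (c : ℝ), ∀ x ∈ Ioo (0 : ℝ) 1,
      fluxOp α r (fun s => rho (γ - 1) (β - 1) s * c) x = Real.pi / S * c := by
    intro c x hx
    rw [← h.fluxOp_rho hx, fluxOp, fluxOp, ← integral_mul_const]
    simp_rw [mul_assoc]
  induction n with
  | zero =>
    intro P hP
    refine ⟨C (Real.pi / S * P.coeff 0), (natDegree_C _).le, by simp [fluxCoeff], fun x hx => ?_⟩
    rw [eq_C_of_natDegree_le_zero hP]
    simp only [eval_C, coeff_C_zero]
    exact hconst _ x hx
  | succ n ih =>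
    intro P hP
    -- The induction uses P = X · P.divX + P(0): the constant part is known, and multiplication by X
    -- is handled by `fluxOp_id_mul`.
    have hP1 : P.divX.natDegree ≤ n := by
      rw [natDegree_divX_eq_natDegree_tsub_one]; omega
    obtain ⟨Q, hQd, hQc, hQ⟩ := ih P.divX hP1
    obtain ⟨R, hR, hRd⟩ := exists_derivative_eq Q hQd
    have hw := h.integrableOn_rho_mul_eval' P.divX
    obtain ⟨c, hc⟩ := integral_fluxPrim_eq_eval h.lt_two r hw (R := R)
      (fun x hx => by rw [hR]; exact hQ x hx)
    -- With R' = Q, the three terms come from x T w, from the primitive kernel integral (2-α)R + c,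
    -- and from the constant part of P.
    refine ⟨X * Q - C (2 - α) * R + C (Real.pi / S * P.coeff 0 - c), ?_, ?_, ?_⟩
    · refine natDegree_add_le_of_degree_le
        ((natDegree_sub_le_of_le ?_ ?_).trans (max_self _).le) ((natDegree_C _).le.trans (by simp))
      · exact natDegree_mul_le.trans (by rw [natDegree_X]; omega)
      · exact (natDegree_C_mul_le _ _).trans hRd
    -- The new leading coefficient carries the factor 1 - (2-α)/(n+1) = (n+α-1)/(n+1), the next
    -- factor of the product in `fluxCoeff`.
    · have hRc : R.coeff (n + 1) * ((n : ℝ) + 1) = Q.coeff n := by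
        rw [← hR, coeff_derivative]
      have hn : (n : ℝ) + 1 ≠ 0 := by positivity
      rw [coeff_add, coeff_sub, coeff_X_mul, coeff_C_mul, coeff_C_succ, add_zero,
        eq_div_of_mul_eq hn hRc, hQc, coeff_divX, fluxCoeff, fluxCoeff, Finset.prod_range_succ]
      field_simp
      ring
    · intro x hx
      have e1 : fluxOp α r (fun s => rho (γ - 1) (β - 1) s * P.eval s) x =
          fluxOp α r (fun s => s * (rho (γ - 1) (β - 1) s * P.divX.eval s)) x +
            fluxOp α r (fun s => rho (γ - 1) (β - 1) s * P.coeff 0) x := by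
        have i1 := (h.integrableOn_fluxKer_mul_rho_mul hx (X * P.divX)).congr_fun
          (g := fun s => fluxKer α r (x - s) * (s * (rho (γ - 1) (β - 1) s * P.divX.eval s)))
          (fun s _ => by simp only [eval_mul, eval_X]; ring) measurableSet_Ioo
        have i2 := h.integrableOn_fluxKer_mul_rho_mul hx (C (P.coeff 0))
        simp only [eval_C] at i2
        unfold fluxOp
        rw [← integral_add i1.integrable i2.integrable]
        refine integral_congr_ae (Eventually.of_forall fun s => ?_)
        simp only
        conv_lhs => rw [← P.divX_mul_X_add]
        simp only [eval_add, eval_mul, eval_X, eval_C]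
        ring
      rw [e1, hconst _ x hx, fluxOp_id_mul h.lt_two r hx hw
        (h.integrableOn_fluxKer_mul_rho_mul hx P.divX), hQ x hx, hc x hx]
      simp only [eval_add, eval_sub, eval_mul, eval_X, eval_C]
      ring

/-- Without the polynomials the integrand is nonnegative and its inner integral is the constant π/S
times an integrable weight. The polynomials are bounded on the unit square, so Fubini applies to the
full expression. -/
lemma integrable_prod_rho (h : Admissible α β γ r) (P Q : ℝ[X]) :
    Integrable (fun p : ℝ × ℝ => (rho (β - 1) (γ - 1) p.1 * P.eval p.1) *
        (fluxKer α r (p.1 - p.2) * (rho (γ - 1) (β - 1) p.2 * Q.eval p.2)))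
      ((volume.restrict (Ioo (0 : ℝ) 1)).prod (volume.restrict (Ioo (0 : ℝ) 1))) := by
  have hbase : Integrable (fun p : ℝ × ℝ => rho (β - 1) (γ - 1) p.1 *
        (fluxKer α r (p.1 - p.2) * rho (γ - 1) (β - 1) p.2))
      ((volume.restrict (Ioo (0 : ℝ) 1)).prod (volume.restrict (Ioo (0 : ℝ) 1))) := by
    rw [integrable_prod_iff]
    · constructor
      · refine ae_restrict_of_forall_mem measurableSet_Ioo fun x hx => ?_
        exact (h.integrableOn_fluxKer_mul_rho hx).integrable.const_mul (rho (β - 1) (γ - 1) x)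
      · have hi : IntegrableOn (fun x => rho (β - 1) (γ - 1) x *
            (Real.pi / (Real.sin (Real.pi * γ) + Real.sin (Real.pi * β)))) (Ioo 0 1) :=
          (integrableOn_rho (by linarith [h.β_pos]) (by linarith [h.γ_pos])).mul_const _
        refine hi.congr ?_
        refine ae_restrict_of_forall_mem measurableSet_Ioo fun x hx => ?_
        simp only
        rw [← h.fluxOp_rho hx, fluxOp, ← integral_const_mul]
        refine setIntegral_congr_fun measurableSet_Ioo fun s hs => ?_
        rw [Real.norm_of_nonneg]
        exact mul_nonneg (rho_pos _ _ hx).le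
          (mul_nonneg (fluxKer_nonneg α h.r_nonneg h.r_le_one _) (rho_pos _ _ hs).le)
    · have m1 := measurable_fluxKer α r
      have m2 := measurable_rho (β - 1) (γ - 1)
      have m3 := measurable_rho (γ - 1) (β - 1)
      exact Measurable.aestronglyMeasurable (by fun_prop)
  have hcont : ContinuousOn (fun p : ℝ × ℝ => P.eval p.1 * Q.eval p.2)
      (Icc (0 : ℝ) 1 ×ˢ Icc (0 : ℝ) 1) :=
    ((P.continuous.comp continuous_fst).mul (Q.continuous.comp continuous_snd)).continuousOn
  rw [Measure.prod_restrict] at hbase ⊢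
  have := IntegrableOn.mul_continuousOn_of_subset hbase hcont
    (measurableSet_Ioo.prod measurableSet_Ioo) (isCompact_Icc.prod isCompact_Icc)
    (prod_mono Ioo_subset_Icc_self Ioo_subset_Icc_self)
  refine this.integrable.congr (Eventually.of_forall fun p => ?_)
  simp only
  ring

/-- The adjoint of `fluxOp α r` is `fluxOp α (1 - r)`. -/
lemma integral_mul_fluxOp (h : Admissible α β γ r) (P Q : ℝ[X]) :
    ∫ x in Ioo (0 : ℝ) 1, (rho (β - 1) (γ - 1) x * P.eval x) *
        fluxOp α r (fun s => rho (γ - 1) (β - 1) s * Q.eval s) x =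
      ∫ s in Ioo (0 : ℝ) 1, (rho (γ - 1) (β - 1) s * Q.eval s) *
        fluxOp α (1 - r) (fun x => rho (β - 1) (γ - 1) x * P.eval x) s := by
  unfold fluxOp
  simp_rw [← integral_const_mul]
  rw [integral_integral_swap (h.integrable_prod_rho P Q)]
  refine integral_congr_ae (Eventually.of_forall fun s => ?_)
  refine integral_congr_ae (Eventually.of_forall fun x => ?_)
  simp only
  rw [← fluxKer_neg, neg_sub]
  ring

/-- `fluxOp` maps the weighted Jacobi basis to the Jacobi basis with swapped parameters. -/
theorem fluxOp_jacobi (h : Admissible α β γ r) (n : ℕ) {x : ℝ} (hx : x ∈ Ioo (0 : ℝ) 1) :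
    fluxOp α r (fun s => rho (γ - 1) (β - 1) s * (jacobiPoly n (γ - 1) (β - 1)).eval s) x =
      fluxCoeff α (Real.sin (Real.pi * γ) + Real.sin (Real.pi * β)) n *
        (jacobiPoly n (β - 1) (γ - 1)).eval x := by
  have hβ : -1 < β - 1 := by linarith [h.β_pos]
  have hγ : -1 < γ - 1 := by linarith [h.γ_pos]
  set b := fluxCoeff α (Real.sin (Real.pi * γ) + Real.sin (Real.pi * β)) n
  obtain ⟨Q, hQd, hQc, hQ⟩ := h.exists_fluxOp_eq_eval n _ (natDegree_jacobiPoly_le n (γ - 1) (β - 1))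
  -- For P of lower degree, the adjoint moves the operator onto P; the image still has degree below
  -- n and is therefore orthogonal to the Jacobi polynomial.
  have horth : ∀ P : ℝ[X], P.degree < n →
      ∫ x in Ioo (0 : ℝ) 1, rho (β - 1) (γ - 1) x * (Q * P).eval x = 0 := by
    intro P hP
    rcases n with _ | m
    · have : P = 0 := by simpa [degree_lt_iff_coeff_zero, Polynomial.ext_iff] using hP
      simp [this]
    · have hPd : P.natDegree ≤ m := by
        rw [natDegree_le_iff_coeff_eq_zero]
        intro k hk
        exact (degree_lt_iff_coeff_zero _ _).mp hP k hk
      obtain ⟨R, hRd, _, hR⟩ := h.swap.exists_fluxOp_eq_eval m P hPd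
      have h1 := h.integral_mul_fluxOp P (jacobiPoly (m + 1) (γ - 1) (β - 1))
      have h3 : ∫ s in Ioo (0 : ℝ) 1,
          (rho (γ - 1) (β - 1) s * (jacobiPoly (m + 1) (γ - 1) (β - 1)).eval s) *
            fluxOp α (1 - r) (fun x => rho (β - 1) (γ - 1) x * P.eval x) s = 0 := by
        refine Eq.trans ?_ (integral_jacobiPoly_mul_eq_zero (m + 1) hγ hβ
          (lt_of_le_of_lt (degree_le_of_natDegree_le hRd)
            (by exact_mod_cast Nat.lt_succ_self m)))
        refine setIntegral_congr_fun measurableSet_Ioo fun s hs => ?_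
        simp only [hR s hs, eval_mul]
        ring
      rw [h3] at h1
      refine Eq.trans ?_ h1
      refine setIntegral_congr_fun measurableSet_Ioo fun s hs => ?_
      simp only [hQ s hs, eval_mul]
      ring
  set D := Q - C b * jacobiPoly n (β - 1) (γ - 1) with hD
  have hDdeg : D.degree < n := by
    rw [degree_lt_iff_coeff_zero]
    intro k hk
    rcases hk.lt_or_eq with hk | rfl
    · rw [hD, coeff_sub, coeff_C_mul, coeff_eq_zero_of_natDegree_lt (hQd.trans_lt hk),
        coeff_eq_zero_of_natDegree_lt ((natDegree_jacobiPoly_le n _ _).trans_lt hk)]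
      ring
    · rw [hD, coeff_sub, coeff_C_mul, hQc, coeff_jacobiPoly_comm n (γ - 1)]
      ring
  -- D has degree below n because leading coefficients match, and both of its terms are orthogonal
  -- to such polynomials; so D is orthogonal to itself.
  have hD0 : D = 0 := by
    refine eq_zero_of_integral_rho_mul_self hβ hγ ?_
    have h1 := horth D hDdeg
    have h2 := integral_jacobiPoly_mul_eq_zero n hβ hγ hDdeg
    calc _ = ∫ x in Ioo (0 : ℝ) 1, (rho (β - 1) (γ - 1) x * (Q * D).eval x -
          b * (rho (β - 1) (γ - 1) x * (jacobiPoly n (β - 1) (γ - 1) * D).eval x)) := by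
          refine integral_congr_ae (Eventually.of_forall fun s => ?_)
          have : D.eval s = Q.eval s - b * (jacobiPoly n (β - 1) (γ - 1)).eval s := by
            rw [hD]; simp
          simp only [eval_mul]
          linear_combination rho (β - 1) (γ - 1) s * D.eval s * this
      _ = 0 := by
          rw [integral_sub (integrableOn_rho_mul_eval hβ hγ _).integrable
            ((integrableOn_rho_mul_eval hβ hγ _).integrable.const_mul b), integral_const_mul,
            h1, h2]
          simp
  rw [hQ x hx, show Q = C b * jacobiPoly n (β - 1) (γ - 1) from sub_eq_zero.mp hD0]
  simp

/-- Integration by parts: `fluxOp w` is a primitive of `fluxOp w'` for `w = ρ^{(γ,β)} P`. -/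
lemma fluxOp_rho_mul_eval (h : Admissible α β γ r) (P : ℝ[X]) {x : ℝ} (hx : x ∈ Ioo (0 : ℝ) 1) :
    (2 - α) * fluxOp α r (fun s => rho γ β s * P.eval s) x =
      ∫ s in Ioo (0 : ℝ) 1, fluxPrim α r (x - s) *
        (rho (γ - 1) (β - 1) s * (weightedDeriv (γ - 1) (β - 1) P).eval s) := by
  have hβ : -1 < β - 1 := by linarith [h.β_pos]
  have hγ : -1 < γ - 1 := by linarith [h.γ_pos]
  have i1 := (integrableOn_fluxPrim_mul h.lt_two r x
    (h.integrableOn_rho_mul_eval' (weightedDeriv (γ - 1) (β - 1) P)))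
  have i2 : IntegrableOn (fun s => fluxKer α r (x - s) * (rho γ β s * P.eval s)) (Ioo 0 1) := by
    refine (h.integrableOn_fluxKer_mul_rho_mul hx (X * (1 - X) * P)).congr_fun
      (fun s hs => ?_) measurableSet_Ioo
    have := rho_add_one_add_one (γ - 1) (β - 1) hs
    rw [sub_add_cancel, sub_add_cancel] at this
    simp only [this, eval_mul, eval_X, eval_sub, eval_one]
    ring
  have key : ∫ s in (0 : ℝ)..1, (fluxPrim α r (x - s) *
        (rho (γ - 1) (β - 1) s * (weightedDeriv (γ - 1) (β - 1) P).eval s) -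
        (2 - α) * (fluxKer α r (x - s) * (rho γ β s * P.eval s))) = 0 := by
    -- The boundary terms vanish with ρ^{(γ,β)} at 0 and 1; the kernel singularity s = x is the
    -- single exceptional point for differentiability.
    rw [integral_eq_of_hasDerivAt_off_countable_of_le
      (fun s => fluxPrim α r (x - s) * (rho γ β s * P.eval s)) _ zero_le_one
      (countable_singleton x)]
    · rw [rho_zero_right h.β_pos.ne', rho_one_right h.γ_pos.ne']
      simp
    · exact ((continuous_fluxPrim h.lt_two r).comp
        (continuous_const.sub continuous_id)).continuousOn.mul
        ((continuousOn_rho h.γ_pos.le h.β_pos.le).mul P.continuous.continuousOn)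
    · rintro s ⟨hs, hsx⟩
      have d1 := (hasDerivAt_fluxPrim h.lt_two r (sub_mem_Ioo hx hs)
        (sub_ne_zero.mpr (Ne.symm hsx))).comp s ((hasDerivAt_id s).const_sub x)
      have d2 := hasDerivAt_rho_mul_eval (γ - 1) (β - 1) P hs
      rw [sub_add_cancel, sub_add_cancel] at d2
      refine (d1.mul d2).congr_deriv ?_
      simp only [Function.comp]
      ring
    · rw [intervalIntegrable_iff_integrableOn_Ioo_of_le zero_le_one]
      exact i1.integrable.sub (i2.integrable.const_mul _)
  rw [intervalIntegral.integral_of_le zero_le_one, integral_Ioc_eq_integral_Ioo,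
    integral_sub i1.integrable (i2.integrable.const_mul _), integral_const_mul] at key
  unfold fluxOp
  linarith

/-- By Rodrigues the derivative of ρ^{(γ,β)} G_n is -(n+1) times a weighted Jacobi function of
degree n+1, which `fluxOp_jacobi` diagonalises. The constant of integration stays unspecified since
only the derivative of Q matters later. -/
theorem exists_fluxOp_rho_jacobi (h : Admissible α β γ r) (n : ℕ) :
    ∃ Q : ℝ[X], derivative Q = C (-(((n : ℝ) + 1) *
        fluxCoeff α (Real.sin (Real.pi * γ) + Real.sin (Real.pi * β)) (n + 1))) *
          jacobiPoly (n + 1) (β - 1) (γ - 1) ∧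
      ∀ x ∈ Ioo (0 : ℝ) 1,
        fluxOp α r (fun s => rho γ β s * jacobiG n γ β s) x = Q.eval x := by
  set S := Real.sin (Real.pi * γ) + Real.sin (Real.pi * β)
  set Q := C (-(((n : ℝ) + 1) * fluxCoeff α S (n + 1))) * jacobiPoly (n + 1) (β - 1) (γ - 1)
    with hQ
  have hQd : Q.natDegree ≤ n + 1 :=
    (natDegree_C_mul_le _ _).trans (natDegree_jacobiPoly_le _ _ _)
  obtain ⟨R, hR, -⟩ := exists_derivative_eq Q hQd
  have hw := h.integrableOn_rho_mul_eval'
    (weightedDeriv (γ - 1) (β - 1) (jacobiPoly n γ β))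
  have hwD := weightedDeriv_jacobiPoly n (γ - 1) (β - 1)
  rw [sub_add_cancel, sub_add_cancel] at hwD
  obtain ⟨c, hc⟩ := integral_fluxPrim_eq_eval h.lt_two r hw (R := R) (fun x hx => by
    have h1 := h.fluxOp_jacobi (n + 1) hx
    rw [hR, hQ, hwD, eval_mul, eval_C, neg_mul, mul_assoc, ← h1, fluxOp, fluxOp,
      ← integral_const_mul, ← integral_neg]
    refine integral_congr_ae (Eventually.of_forall fun s => ?_)
    simp only [eval_neg, eval_mul, eval_C]
    ring)
  have h2α : 2 - α ≠ 0 := by linarith [h.lt_two]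
  refine ⟨R + C (c / (2 - α)), by simp [hR], fun x hx => ?_⟩
  have h2 := h.fluxOp_rho_mul_eval (jacobiPoly n γ β) hx
  rw [hc x hx] at h2
  simp_rw [eval_jacobiPoly] at h2
  apply mul_left_cancel₀ h2α
  rw [h2, eval_add, eval_C]
  field_simp

theorem exists_fluxOp_id_mul_rho (h : Admissible α β γ r) :
    ∃ Q : ℝ[X], derivative Q =
        C (fluxCoeff α (Real.sin (Real.pi * γ) + Real.sin (Real.pi * β)) 1) ∧
      ∀ x ∈ Ioo (0 : ℝ) 1, fluxOp α r (fun s => rho (γ - 1) (β - 1) s * s) x = Q.eval x := by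
  obtain ⟨Q, hQd, hQc, hQ⟩ := h.exists_fluxOp_eq_eval 1 X natDegree_X_le
  refine ⟨Q, ?_, fun x hx => by simpa using hQ x hx⟩
  rw [eq_X_add_C_of_natDegree_le_one hQd, hQc]
  simp

end Admissible

/-! ### Orthonormal series in L² -/

lemma inner_toLp_toLp {μ : Measure ℝ} {f g : ℝ → ℝ} (hf : MemLp f 2 μ) (hg : MemLp g 2 μ) :
    inner ℝ (hf.toLp f) (hg.toLp g) = ∫ x, f x * g x ∂μ := by
  rw [L2.inner_def]
  refine integral_congr_ae ?_
  filter_upwards [hf.coeFn_toLp, hg.coeFn_toLp] with x h1 h2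
  rw [h1, h2]
  simp [mul_comm]

lemma orthonormal_toLp {μ : Measure ℝ} {u : ℕ → ℝ → ℝ} (hu : ∀ i, MemLp (u i) 2 μ)
    (h : ∀ i j, ∫ x, u i x * u j x ∂μ = if i = j then 1 else 0) :
    Orthonormal ℝ fun i => (hu i).toLp (u i) := by
  rw [orthonormal_iff_ite]
  intro i j
  rw [inner_toLp_toLp, h]

lemma toLp_sum_smul {μ : Measure ℝ} {u : ℕ → ℝ → ℝ} (hu : ∀ i, MemLp (u i) 2 μ) (d : ℕ → ℝ)
    (N : ℕ) (hs : MemLp (fun x => ∑ i ∈ Finset.range N, d i * u i x) 2 μ) :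
    hs.toLp _ = ∑ i ∈ Finset.range N, d i • (hu i).toLp (u i) := by
  induction N with
  | zero => simp only [Finset.range_zero, Finset.sum_empty]; exact MemLp.toLp_zero _
  | succ N ih =>
    have hs' : MemLp (fun x => ∑ i ∈ Finset.range N, d i * u i x) 2 μ :=
      memLp_finsetSum _ fun i _ => (hu i).const_mul (d i)
    rw [Finset.sum_range_succ, ← ih hs', ← MemLp.toLp_const_smul, ← MemLp.toLp_add,
      MemLp.toLp_eq_toLp_iff]
    refine Eventually.of_forall fun x => ?_
    simp [Finset.sum_range_succ]

/-- Square-summable coefficients against an orthonormal system give an `L²`-convergent series. -/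
lemma exists_tendsto_of_summable_sq {μ : Measure ℝ} {u : ℕ → ℝ → ℝ} (hu : ∀ i, MemLp (u i) 2 μ)
    (h : ∀ i j, ∫ x, u i x * u j x ∂μ = if i = j then 1 else 0) {d : ℕ → ℝ}
    (hd : Summable fun i => d i ^ 2) :
    ∃ g : ℝ → ℝ, MemLp g 2 μ ∧ Tendsto (fun N : ℕ =>
      eLpNorm ((fun x => ∑ i ∈ Finset.range N, d i * u i x) - g) 2 μ) atTop (𝓝 0) := by
  have ho := (orthonormal_toLp hu h).orthogonalFamily
  have hsum : Summable fun i => d i • (hu i).toLp (u i) := by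
    have := (ho.summable_iff_norm_sq_summable d).mpr (by simpa using hd)
    simpa using this
  have ht := hsum.hasSum.tendsto_sum_nat
  set G := ∑' i, d i • (hu i).toLp (u i)
  have hs : ∀ N, MemLp (fun x => ∑ i ∈ Finset.range N, d i * u i x) 2 μ := fun N =>
    memLp_finsetSum _ fun i _ => (hu i).const_mul (d i)
  refine ⟨G, Lp.memLp G, ?_⟩
  rw [← Lp.tendsto_Lp_iff_tendsto_eLpNorm'' _ hs _ (Lp.memLp G), Lp.toLp_coeFn]
  exact ht.congr fun N => (toLp_sum_smul hu d N (hs N)).symm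

/-! ### The weighted L² spaces -/

lemma measurable_ofReal_rho (a b : ℝ) : Measurable fun x => ENNReal.ofReal (rho a b x) :=
  (measurable_rho a b).ennreal_ofReal

lemma integrable_weightedMeasure_iff {a b : ℝ} {g : ℝ → ℝ} :
    Integrable g (weightedMeasure a b) ↔ IntegrableOn (fun x => rho a b x * g x) (Ioo 0 1) := by
  rw [weightedMeasure, integrable_withDensity_iff_integrable_smul' (measurable_ofReal_rho a b)
    (Eventually.of_forall fun x => ENNReal.ofReal_lt_top)]
  refine integrable_congr (ae_restrict_of_forall_mem measurableSet_Ioo fun x hx => ?_)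
  simp only [smul_eq_mul]
  rw [ENNReal.toReal_ofReal (rho_pos a b hx).le]

lemma integral_weightedMeasure (a b : ℝ) (g : ℝ → ℝ) :
    ∫ x, g x ∂(weightedMeasure a b) = ∫ x in Ioo (0 : ℝ) 1, rho a b x * g x := by
  rw [weightedMeasure, integral_withDensity_eq_integral_toReal_smul (measurable_ofReal_rho a b)
    (Eventually.of_forall fun x => ENNReal.ofReal_lt_top)]
  refine setIntegral_congr_fun measurableSet_Ioo fun x hx => ?_
  simp only [smul_eq_mul]
  rw [ENNReal.toReal_ofReal (rho_pos a b hx).le]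

lemma isFiniteMeasure_weightedMeasure {a b : ℝ} (ha : -1 < a) (hb : -1 < b) :
    IsFiniteMeasure (weightedMeasure a b) :=
  isFiniteMeasure_withDensity_ofReal (integrableOn_rho ha hb).integrable.2

lemma ae_mem_Ioo_weightedMeasure (a b : ℝ) : ∀ᵐ x ∂(weightedMeasure a b), x ∈ Ioo (0 : ℝ) 1 :=
  (withDensity_absolutelyContinuous _ _).ae_le (ae_restrict_mem measurableSet_Ioo)

lemma restrict_le_weightedMeasure {a b : ℝ} (ha : a ≤ 0) (hb : b ≤ 0) :
    volume.restrict (Ioo (0 : ℝ) 1) ≤ weightedMeasure a b := by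
  unfold weightedMeasure
  conv_lhs => rw [← withDensity_one (μ := volume.restrict (Ioo (0 : ℝ) 1))]
  refine withDensity_mono (ae_restrict_of_forall_mem measurableSet_Ioo fun x hx => ?_)
  rw [Pi.one_apply, ENNReal.one_le_ofReal, rho]
  exact one_le_mul_of_one_le_of_one_le
    (Real.one_le_rpow_of_pos_of_le_one_of_nonpos (by linarith [hx.2]) (by linarith [hx.1]) ha)
    (Real.one_le_rpow_of_pos_of_le_one_of_nonpos hx.1 hx.2.le hb)

instance : IsProbabilityMeasure (volume.restrict (Ioo (0 : ℝ) 1)) := ⟨by simp⟩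

/-- The interval has length one, so L¹ ≤ L² without a constant, and for nonpositive exponents the
weight is at least 1. -/
lemma eLpNorm_one_le_weighted {a b : ℝ} (ha : a ≤ 0) (hb : b ≤ 0) {g : ℝ → ℝ}
    (hg : AEStronglyMeasurable g (weightedMeasure a b)) :
    eLpNorm g 1 (volume.restrict (Ioo (0 : ℝ) 1)) ≤ eLpNorm g 2 (weightedMeasure a b) :=
  (eLpNorm_le_eLpNorm_of_exponent_le (by norm_num)
    (hg.mono_measure (restrict_le_weightedMeasure ha hb))).trans
    (eLpNorm_mono_measure g (restrict_le_weightedMeasure ha hb))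

lemma integrableOn_of_memLp_weighted {a b : ℝ} (ha : a ≤ 0) (hb : b ≤ 0) {g : ℝ → ℝ}
    (hg : MemLp g 2 (weightedMeasure a b)) : IntegrableOn g (Ioo 0 1) :=
  (hg.mono_measure (restrict_le_weightedMeasure ha hb)).integrable (by norm_num)

lemma memLp_continuous_weighted {a b : ℝ} (ha : -1 < a) (hb : -1 < b) {g : ℝ → ℝ}
    (hg : Continuous g) : MemLp g 2 (weightedMeasure a b) := by
  rw [memLp_two_iff_integrable_sq hg.aestronglyMeasurable, integrable_weightedMeasure_iff]
  exact integrableOn_rho_mul ha hb (hg.pow 2)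

/-- This says that multiplication by ρ^{(a,b)} is an isometry from L² with weight ρ^{(a,b)} to L²
with weight ρ^{(-a,-b)}, which transports orthonormal systems. -/
lemma rho_neg_mul_rho_mul_rho (a b : ℝ) {x : ℝ} (hx : x ∈ Ioo (0 : ℝ) 1) :
    rho (-a) (-b) x * (rho a b x * rho a b x) = rho a b x := by
  have hx1 : 0 < 1 - x := by linarith [hx.2]
  have h2 : (1 - x) ^ a ≠ 0 := (Real.rpow_pos_of_pos hx1 a).ne'
  have h3 : x ^ b ≠ 0 := (Real.rpow_pos_of_pos hx.1 b).ne'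
  rw [rho, rho, Real.rpow_neg hx1.le, Real.rpow_neg hx.1.le]
  field_simp

lemma memLp_rho_mul_weighted {a b : ℝ} (ha : -1 < a) (hb : -1 < b) {g : ℝ → ℝ}
    (hg : Continuous g) :
    MemLp (fun x => rho a b x * g x) 2 (weightedMeasure (-a) (-b)) := by
  have hm : AEStronglyMeasurable (fun x => rho a b x * g x) (weightedMeasure (-a) (-b)) :=
    ((measurable_rho a b).mul hg.measurable).aestronglyMeasurable
  rw [memLp_two_iff_integrable_sq hm, integrable_weightedMeasure_iff]
  refine (integrableOn_rho_mul ha hb (hg.pow 2)).congr_fun (fun x hx => ?_) measurableSet_Ioo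
  simp only [Pi.pow_apply]
  linear_combination (-(g x ^ 2)) * rho_neg_mul_rho_mul_rho a b hx

lemma continuous_jacobiG (n : ℕ) (a b : ℝ) : Continuous (jacobiG n a b) := by
  have : jacobiG n a b = fun x => (jacobiPoly n a b).eval x :=
    funext fun x => (eval_jacobiPoly n a b x).symm
  rw [this]
  exact (jacobiPoly n a b).continuous

lemma integral_jacobiG_mul {a b : ℝ} (ha : -1 < a) (hb : -1 < b) (i j : ℕ) :
    ∫ x in Ioo (0 : ℝ) 1, rho a b x * (jacobiG i a b x * jacobiG j a b x) =
      if i = j then normSqG i a b else 0 := by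
  split_ifs with hij
  · subst hij
    simp only [normSqG, pow_two]
  · rcases Nat.lt_or_gt_of_ne hij with h | h
    · have := integral_jacobiPoly_mul_eq_zero j ha hb (Q := jacobiPoly i a b)
        (by rw [degree_jacobiPoly i ha hb]; exact_mod_cast h)
      refine Eq.trans (integral_congr_ae (Eventually.of_forall fun x => ?_)) this
      simp only [eval_mul, eval_jacobiPoly]
      ring
    · have := integral_jacobiPoly_mul_eq_zero i ha hb (Q := jacobiPoly j a b)
        (by rw [degree_jacobiPoly j ha hb]; exact_mod_cast h)
      refine Eq.trans (integral_congr_ae (Eventually.of_forall fun x => ?_)) this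
      simp only [eval_mul, eval_jacobiPoly]

/-! ### Completeness of the Jacobi polynomials -/

/-- The normalized transplanted Jacobi polynomials. -/
noncomputable def jacobiN (n : ℕ) (a b x : ℝ) : ℝ := (√(normSqG n a b))⁻¹ * jacobiG n a b x

lemma continuous_jacobiN (n : ℕ) (a b : ℝ) : Continuous (jacobiN n a b) :=
  continuous_const.mul (continuous_jacobiG n a b)

lemma integral_jacobiN_mul {a b : ℝ} (ha : -1 < a) (hb : -1 < b) (i j : ℕ) :
    ∫ x in Ioo (0 : ℝ) 1, rho a b x * (jacobiN i a b x * jacobiN j a b x) =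
      if i = j then 1 else 0 := by
  have h : ∀ x, rho a b x * (jacobiN i a b x * jacobiN j a b x) =
      ((√(normSqG i a b))⁻¹ * (√(normSqG j a b))⁻¹) *
        (rho a b x * (jacobiG i a b x * jacobiG j a b x)) := fun x => by
    rw [jacobiN, jacobiN]; ring
  simp_rw [h]
  rw [integral_const_mul, integral_jacobiG_mul ha hb]
  split_ifs with hij
  · subst hij
    have h1 := normSqG_pos i ha hb
    rw [← mul_inv, Real.mul_self_sqrt h1.le, inv_mul_cancel₀ h1.ne']
  · simp

lemma jacobiN_orthonormal_weighted {a b : ℝ} (ha : -1 < a) (hb : -1 < b) (i j : ℕ) :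
    ∫ x, jacobiN i a b x * jacobiN j a b x ∂(weightedMeasure a b) = if i = j then 1 else 0 := by
  rw [integral_weightedMeasure, integral_jacobiN_mul ha hb]

lemma rho_jacobiN_orthonormal_weighted {a b : ℝ} (ha : -1 < a) (hb : -1 < b) (i j : ℕ) :
    ∫ x, (rho a b x * jacobiN i a b x) * (rho a b x * jacobiN j a b x)
      ∂(weightedMeasure (-a) (-b)) = if i = j then 1 else 0 := by
  rw [integral_weightedMeasure, ← integral_jacobiN_mul ha hb]
  refine setIntegral_congr_fun measurableSet_Ioo fun x hx => ?_
  linear_combination (jacobiN i a b x * jacobiN j a b x) * rho_neg_mul_rho_mul_rho a b hx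

lemma memLp_jacobiN {a b : ℝ} (ha : -1 < a) (hb : -1 < b) (i : ℕ) :
    MemLp (jacobiN i a b) 2 (weightedMeasure a b) :=
  memLp_continuous_weighted ha hb (continuous_jacobiN i a b)

lemma orthonormal_jacobiN {a b : ℝ} (ha : -1 < a) (hb : -1 < b) :
    Orthonormal ℝ fun i => (memLp_jacobiN ha hb i).toLp (jacobiN i a b) :=
  orthonormal_toLp _ (jacobiN_orthonormal_weighted ha hb)

lemma integrable_mul_continuous_weighted {a b : ℝ} (ha : -1 < a) (hb : -1 < b) {g p : ℝ → ℝ}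
    (hg : MemLp g 2 (weightedMeasure a b)) (hp : Continuous p) :
    Integrable (fun x => g x * p x) (weightedMeasure a b) :=
  hg.integrable_mul (memLp_continuous_weighted ha hb hp)

/-- A function orthogonal to all Jacobi polynomials is orthogonal to all polynomials. -/
lemma integral_mul_eval_eq_zero {a b : ℝ} (ha : -1 < a) (hb : -1 < b) {g : ℝ → ℝ}
    (hg : MemLp g 2 (weightedMeasure a b))
    (h : ∀ i, ∫ x, g x * (jacobiPoly i a b).eval x ∂(weightedMeasure a b) = 0) (n : ℕ) :
    ∀ P : ℝ[X], P.degree < n → ∫ x, g x * P.eval x ∂(weightedMeasure a b) = 0 := by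
  induction n with
  | zero =>
    intro P hP
    have : P = 0 := by simpa [degree_lt_iff_coeff_zero, Polynomial.ext_iff] using hP
    simp [this]
  | succ n ih =>
    intro P hP
    have hJ := coeff_jacobiPoly_pos n a b ha hb
    set c := P.coeff n / (jacobiPoly n a b).coeff n with hc
    have hdeg : (P - C c * jacobiPoly n a b).degree < n := by
      rw [degree_lt_iff_coeff_zero] at hP ⊢
      intro k hk
      rw [coeff_sub, coeff_C_mul]
      rcases hk.lt_or_eq with hk | rfl
      · rw [hP k hk, coeff_eq_zero_of_natDegree_lt ((natDegree_jacobiPoly_le n a b).trans_lt hk)]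
        ring
      · rw [hc]; field_simp; ring
    have h1 := ih _ hdeg
    have hi := integrable_mul_continuous_weighted ha hb hg (jacobiPoly n a b).continuous
    have hi2 := integrable_mul_continuous_weighted ha hb hg (P - C c * jacobiPoly n a b).continuous
    calc _ = ∫ x, (g x * (P - C c * jacobiPoly n a b).eval x +
          c * (g x * (jacobiPoly n a b).eval x)) ∂(weightedMeasure a b) := by
          refine integral_congr_ae (Eventually.of_forall fun x => ?_)
          simp only [eval_sub, eval_mul, eval_C]
          ring
      _ = 0 := by
          rw [integral_add hi2 (hi.const_mul c), integral_const_mul, h1, h n]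
          simp

/-- The measure is finite, so g is integrable, and Weierstrass approximation on [0,1] extends
orthogonality from polynomials to smooth test functions. -/
lemma ae_eq_zero_of_integral_mul_eval_eq_zero {a b : ℝ} (ha : -1 < a) (hb : -1 < b) {g : ℝ → ℝ}
    (hg : MemLp g 2 (weightedMeasure a b))
    (h : ∀ P : ℝ[X], ∫ x, g x * P.eval x ∂(weightedMeasure a b) = 0) :
    g =ᵐ[weightedMeasure a b] 0 := by
  have hfin := isFiniteMeasure_weightedMeasure ha hb
  have hgi : Integrable g (weightedMeasure a b) := hg.integrable (by norm_num)
  have key : ∀ᵐ x ∂(weightedMeasure a b), x ∈ Ioo (0 : ℝ) 1 → g x = 0 := by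
    refine isOpen_Ioo.ae_eq_zero_of_integral_contDiff_smul_eq_zero
      (hgi.locallyIntegrable.locallyIntegrableOn _) fun φ hφ _ _ => ?_
    have hφc : Continuous φ := hφ.continuous
    set M := ∫ x, |g x| ∂(weightedMeasure a b) with hM
    have hM0 : 0 ≤ M := integral_nonneg fun x => abs_nonneg _
    have hbound : ∀ ε : ℝ, 0 < ε → |∫ x, φ x • g x ∂(weightedMeasure a b)| ≤ ε * M := by
      intro ε hε
      obtain ⟨p, hp⟩ := exists_polynomial_near_of_continuousOn 0 1 φ hφc.continuousOn ε hε
      have e1 : ∫ x, φ x • g x ∂(weightedMeasure a b) =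
          ∫ x, (φ x - p.eval x) * g x ∂(weightedMeasure a b) := by
        have i1 := integrable_mul_continuous_weighted ha hb hg hφc
        have i2 := integrable_mul_continuous_weighted ha hb hg p.continuous
        have := integral_sub i1 i2
        rw [h p, sub_zero] at this
        refine Eq.trans ?_ (this.symm.trans ?_)
        · refine integral_congr_ae (Eventually.of_forall fun x => ?_)
          simp [mul_comm]
        · refine integral_congr_ae (Eventually.of_forall fun x => ?_)
          simp only
          ring
      rw [e1, hM, ← integral_const_mul, ← Real.norm_eq_abs]
      refine norm_integral_le_of_norm_le (hgi.abs.const_mul ε) ?_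
      filter_upwards [ae_mem_Ioo_weightedMeasure a b] with x hx
      rw [norm_mul]
      refine mul_le_mul_of_nonneg_right ?_ (abs_nonneg _)
      rw [Real.norm_eq_abs, abs_sub_comm]
      exact (hp x (Ioo_subset_Icc_self hx)).le
    have h0 : |∫ x, φ x • g x ∂(weightedMeasure a b)| ≤ 0 := by
      refine le_of_forall_pos_le_add fun δ hδ => ?_
      -- The denominator M + 1 avoids the case M = 0.
      have := hbound (δ / (M + 1)) (by positivity)
      refine this.trans ?_
      rw [zero_add, div_mul_eq_mul_div, div_le_iff₀ (by positivity)]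
      nlinarith
    exact abs_nonpos_iff.mp h0
  filter_upwards [key, ae_mem_Ioo_weightedMeasure a b] with x h1 h2 using h1 h2

/-- The Jacobi polynomials form a Hilbert basis of their weighted `L²` space. -/
lemma exists_hilbertBasis_jacobiN {a b : ℝ} (ha : -1 < a) (hb : -1 < b) :
    ∃ B : HilbertBasis ℕ ℝ (Lp ℝ 2 (weightedMeasure a b)),
      ∀ i, B i = (memLp_jacobiN ha hb i).toLp (jacobiN i a b) := by
  have ho := orthonormal_jacobiN ha hb
  have hsp : (Submodule.span ℝ
      (range fun i => (memLp_jacobiN ha hb i).toLp (jacobiN i a b)))ᗮ = ⊥ := by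
    rw [Submodule.eq_bot_iff]
    intro g hg
    rw [Submodule.mem_orthogonal'] at hg
    have hgm := Lp.memLp g
    have hperp : ∀ i, ∫ x, g x * (jacobiPoly i a b).eval x ∂(weightedMeasure a b) = 0 := by
      intro i
      have h1 := hg _ (Submodule.subset_span (mem_range_self i))
      rw [← Lp.toLp_coeFn g hgm, inner_toLp_toLp] at h1
      have h2 : ∀ x, g x * jacobiN i a b x =
          (√(normSqG i a b))⁻¹ * (g x * (jacobiPoly i a b).eval x) := fun x => by
        rw [jacobiN, eval_jacobiPoly]; ring
      simp_rw [h2] at h1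
      rw [integral_const_mul] at h1
      refine (mul_eq_zero.mp h1).resolve_left (inv_ne_zero ?_)
      exact (Real.sqrt_pos.mpr (normSqG_pos i ha hb)).ne'
    have := ae_eq_zero_of_integral_mul_eval_eq_zero ha hb hgm fun P =>
      integral_mul_eval_eq_zero ha hb hgm hperp (P.natDegree + 1) P
        (lt_of_le_of_lt degree_le_natDegree (by exact_mod_cast Nat.lt_succ_self _))
    exact (Lp.eq_zero_iff_ae_eq_zero).mpr this
  refine ⟨HilbertBasis.mkOfOrthogonalEqBot ho hsp, fun i => ?_⟩
  rw [HilbertBasis.coe_mkOfOrthogonalEqBot]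

/-- Parseval's identity for the Jacobi expansion of `g`, tested against `p`. -/
lemma hasSum_jacobi_coeff {a b : ℝ} (ha : -1 < a) (hb : -1 < b) {g p : ℝ → ℝ}
    (hg : MemLp g 2 (weightedMeasure a b)) (hp : MemLp p 2 (weightedMeasure a b)) :
    HasSum (fun i => (∫ x in Ioo (0 : ℝ) 1, rho a b x * g x * jacobiG i a b x) / normSqG i a b *
        ∫ x in Ioo (0 : ℝ) 1, rho a b x * p x * jacobiG i a b x)
      (∫ x in Ioo (0 : ℝ) 1, rho a b x * g x * p x) := by
  obtain ⟨B, hB⟩ := exists_hilbertBasis_jacobiN ha hb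
  have h := B.hasSum_inner_mul_inner (hg.toLp g) (hp.toLp p)
  rw [inner_toLp_toLp, integral_weightedMeasure] at h
  simp_rw [← mul_assoc] at h
  refine (congrArg (fun F => HasSum F _) (funext fun i => ?_)).mpr h
  rw [hB, inner_toLp_toLp, inner_toLp_toLp, integral_weightedMeasure, integral_weightedMeasure]
  have e1 : ∀ x, rho a b x * (g x * jacobiN i a b x) =
      (√(normSqG i a b))⁻¹ * (rho a b x * g x * jacobiG i a b x) := fun x => by
    rw [jacobiN]; ring
  have e2 : ∀ x, rho a b x * (jacobiN i a b x * p x) =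
      (√(normSqG i a b))⁻¹ * (rho a b x * p x * jacobiG i a b x) := fun x => by
    rw [jacobiN]; ring
  simp_rw [e1, e2]
  rw [integral_const_mul, integral_const_mul]
  have hn := normSqG_pos i ha hb
  have hs : (√(normSqG i a b))⁻¹ * (√(normSqG i a b))⁻¹ = (normSqG i a b)⁻¹ := by
    rw [← mul_inv, Real.mul_self_sqrt hn.le]
  rw [div_eq_mul_inv, ← hs]
  ring

/-- Bessel's inequality for the Jacobi expansion. -/
lemma summable_jacobi_coeff_sq {a b : ℝ} (ha : -1 < a) (hb : -1 < b) {g : ℝ → ℝ}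
    (hg : MemLp g 2 (weightedMeasure a b)) :
    Summable fun i => (∫ x in Ioo (0 : ℝ) 1, rho a b x * g x * jacobiG i a b x) ^ 2 /
      normSqG i a b := by
  refine (hasSum_jacobi_coeff ha hb hg hg).summable.congr fun i => ?_
  ring

/-! ### Closed forms of the diagonal coefficients -/

/-- The product telescopes by the functional equation of Γ; the initial value π is rewritten by the
reflection formula at α-1, using sin(πα) = -sin(π(α-1)). -/
lemma fluxCoeff_eq {α S : ℝ} (hα₁ : 1 < α) (hα₂ : α < 2) (n : ℕ) :
    fluxCoeff α S n = Real.Gamma (2 - α) *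
      (-(Real.sin (Real.pi * α) / S) * (Real.Gamma (n + α - 1) / n.factorial)) := by
  have hsin : Real.sin (Real.pi * α) = -Real.sin (Real.pi * (α - 1)) := by
    rw [mul_sub, mul_one, Real.sin_sub_pi, neg_neg]
  have hs : 0 < Real.sin (Real.pi * (α - 1)) := Admissible.sin_pos (by linarith) (by linarith)
  have hΓ := Real.Gamma_mul_Gamma_one_sub (α - 1)
  rw [show 1 - (α - 1) = 2 - α by ring] at hΓ
  induction n with
  | zero =>
    have : Real.pi = Real.Gamma (α - 1) * Real.Gamma (2 - α) * Real.sin (Real.pi * (α - 1)) := by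
      rw [hΓ]; field_simp
    simp only [fluxCoeff, Finset.range_zero, Finset.prod_empty, mul_one, Nat.cast_zero, zero_add,
      Nat.factorial_zero, Nat.cast_one, div_one]
    rw [hsin]
    calc Real.pi / S = Real.Gamma (α - 1) * Real.Gamma (2 - α) * Real.sin (Real.pi * (α - 1)) / S :=
          by rw [← this]
      _ = _ := by ring
  | succ n ih =>
    have h1 : fluxCoeff α S (n + 1) = fluxCoeff α S n * (((n : ℝ) + α - 1) / ((n : ℝ) + 1)) := by
      rw [fluxCoeff, fluxCoeff, Finset.prod_range_succ, mul_assoc]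
    have hn : (n : ℝ) + α - 1 ≠ 0 := by
      have : (0 : ℝ) ≤ n := Nat.cast_nonneg n
      linarith
    have h2 : Real.Gamma ((n + 1 : ℕ) + α - 1) = ((n : ℝ) + α - 1) * Real.Gamma (n + α - 1) := by
      rw [← Real.Gamma_add_one hn]
      congr 1; push_cast; ring
    rw [h1, ih, h2, Nat.factorial_succ]
    push_cast
    have h3 : (n : ℝ) + 1 ≠ 0 := by positivity
    have h4 : (n.factorial : ℝ) ≠ 0 := by positivity
    field_simp

lemma fluxCoeff_one {α β : ℝ} (hα₁ : 1 < α) (hα₂ : α < 2) :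
    fluxCoeff α (Real.sin (Real.pi * (α - β)) + Real.sin (Real.pi * β)) 1 =
      Real.Gamma (2 - α) * lamNegOne α β := by
  rw [fluxCoeff_eq hα₁ hα₂, lamNegOne]
  simp only [Nat.cast_one, Nat.factorial_one, div_one, add_sub_cancel_left]
  ring

/-- The factor n+1 from Rodrigues turns (n+1)! into n!, which is why the coefficient of index n+1
gives λ_n. -/
lemma succ_mul_fluxCoeff_succ {α β : ℝ} (hα₁ : 1 < α) (hα₂ : α < 2) (n : ℕ) :
    ((n : ℝ) + 1) * fluxCoeff α (Real.sin (Real.pi * (α - β)) + Real.sin (Real.pi * β)) (n + 1) =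
      -(Real.Gamma (2 - α) * lam α β n) := by
  rw [fluxCoeff_eq hα₁ hα₂, lam, Nat.factorial_succ,
    show (((n + 1 : ℕ) : ℝ) + α - 1) = n + α by push_cast; ring]
  push_cast
  have h3 : (n : ℝ) + 1 ≠ 0 := by positivity
  have h4 : (n.factorial : ℝ) ≠ 0 := by positivity
  field_simp

lemma sin_pi_mul_neg {α : ℝ} (hα₁ : 1 < α) (hα₂ : α < 2) : Real.sin (Real.pi * α) < 0 := by
  have hs : 0 < Real.sin (Real.pi * (α - 1)) := Admissible.sin_pos (by linarith) (by linarith)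
  rw [mul_sub, mul_one, Real.sin_sub_pi] at hs
  linarith

lemma lam_succ {α β : ℝ} (hα₁ : 1 < α) (n : ℕ) :
    lam α β (n + 1) = lam α β n * (((n : ℝ) + α) / ((n : ℝ) + 1)) := by
  have hn : (n : ℝ) + α ≠ 0 := by positivity
  rw [lam, lam, show (((n + 1 : ℕ) : ℝ) + α) = n + α + 1 by push_cast; ring,
    Real.Gamma_add_one hn, Nat.factorial_succ]
  push_cast
  have h3 : (n : ℝ) + 1 ≠ 0 := by positivity
  have h4 : (n.factorial : ℝ) ≠ 0 := by positivity
  field_simp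

/-! ### Fractional integrals through the flux operator, and duality -/

/-- The kernel of the left fractional integral, cut off to its domain of integration. -/
lemma powKer_sub_mul {α x s : ℝ} (hx : x ∈ Ioo (0 : ℝ) 1) (hs : s ∈ Ioo (0 : ℝ) 1) (w : ℝ → ℝ) :
    powKer α (x - s) * w s =
      (Ioo 0 x).indicator (fun s => w s / (x - s) ^ (1 - (2 - α))) s := by
  by_cases h : s < x
  · rw [powKer_of_mem ⟨by linarith, by linarith [hx.2, hs.1]⟩,
      indicator_of_mem (show s ∈ Ioo 0 x from ⟨hs.1, h⟩),
      show 1 - α = -(1 - (2 - α)) by ring, Real.rpow_neg (by linarith)]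
    ring
  · rw [powKer_of_neg (by linarith), indicator_of_notMem (fun h' => h h'.2), zero_mul]

lemma powKer_neg_sub_mul {α x s : ℝ} (hx : x ∈ Ioo (0 : ℝ) 1) (hs : s ∈ Ioo (0 : ℝ) 1)
    (w : ℝ → ℝ) :
    powKer α (-(x - s)) * w s =
      (Ioo x 1).indicator (fun s => w s / (s - x) ^ (1 - (2 - α))) s := by
  rw [neg_sub]
  by_cases h : x < s
  · rw [powKer_of_mem ⟨by linarith, by linarith [hx.1, hs.2]⟩,
      indicator_of_mem (show s ∈ Ioo x 1 from ⟨h, hs.2⟩),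
      show 1 - α = -(1 - (2 - α)) by ring, Real.rpow_neg (by linarith)]
    ring
  · rw [powKer_of_neg (by linarith), indicator_of_notMem (fun h' => h h'.1), zero_mul]

lemma Ioo_inter_Ioo_left {x : ℝ} (hx : x ∈ Ioo (0 : ℝ) 1) : Ioo 0 1 ∩ Ioo 0 x = Ioo 0 x :=
  inter_eq_right.mpr (Ioo_subset_Ioo_right hx.2.le)

lemma Ioo_inter_Ioo_right {x : ℝ} (hx : x ∈ Ioo (0 : ℝ) 1) : Ioo 0 1 ∩ Ioo x 1 = Ioo x 1 :=
  inter_eq_right.mpr (Ioo_subset_Ioo_left hx.1.le)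

lemma leftFracInt_eq {α x : ℝ} (hx : x ∈ Ioo (0 : ℝ) 1) (w : ℝ → ℝ) :
    leftFracInt (2 - α) w x =
      1 / Real.Gamma (2 - α) * ∫ s in Ioo (0 : ℝ) 1, powKer α (x - s) * w s := by
  rw [leftFracInt, setIntegral_congr_fun measurableSet_Ioo
    (fun s hs => powKer_sub_mul hx hs w), setIntegral_indicator measurableSet_Ioo,
    Ioo_inter_Ioo_left hx]

lemma rightFracInt_eq {α x : ℝ} (hx : x ∈ Ioo (0 : ℝ) 1) (w : ℝ → ℝ) :
    rightFracInt (2 - α) w x =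
      1 / Real.Gamma (2 - α) * ∫ s in Ioo (0 : ℝ) 1, powKer α (-(x - s)) * w s := by
  rw [rightFracInt, setIntegral_congr_fun measurableSet_Ioo
    (fun s hs => powKer_neg_sub_mul hx hs w), setIntegral_indicator measurableSet_Ioo,
    Ioo_inter_Ioo_right hx]

lemma ae_integrableOn_powKer {α : ℝ} (hα : α < 2) {w : ℝ → ℝ} (hw : IntegrableOn w (Ioo 0 1)) :
    ∀ᵐ x ∂(volume.restrict (Ioo (0 : ℝ) 1)),
      IntegrableOn (fun s => powKer α (x - s) * w s) (Ioo 0 1) ∧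
      IntegrableOn (fun s => powKer α (-(x - s)) * w s) (Ioo 0 1) := by
  have h1 := (integrable_prod_comp_sub_mul (integrable_powKer hα) hw (Ioo 0 1)).prod_right_ae
  have h2 := (integrable_prod_comp_sub_mul (integrable_powKer hα).comp_neg hw
    (Ioo 0 1)).prod_right_ae
  filter_upwards [h1, h2] with x h1 h2 using ⟨h1, h2⟩

lemma ae_integrableOn_fracInt {α : ℝ} (hα : α < 2) {w : ℝ → ℝ} (hw : IntegrableOn w (Ioo 0 1)) :
    ∀ᵐ x ∂(volume.restrict (Ioo (0 : ℝ) 1)),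
      IntegrableOn (fun s => w s / (x - s) ^ (1 - (2 - α))) (Ioo 0 x) ∧
      IntegrableOn (fun s => w s / (s - x) ^ (1 - (2 - α))) (Ioo x 1) := by
  filter_upwards [ae_integrableOn_powKer hα hw, ae_restrict_mem measurableSet_Ioo] with x h hx
  constructor
  · have := h.1.congr_fun (fun s hs => powKer_sub_mul hx hs w) measurableSet_Ioo
    rw [IntegrableOn, integrable_indicator_iff measurableSet_Ioo, IntegrableOn,
      Measure.restrict_restrict measurableSet_Ioo, inter_comm, Ioo_inter_Ioo_left hx] at this
    exact this
  · have := h.2.congr_fun (fun s hs => powKer_neg_sub_mul hx hs w) measurableSet_Ioo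
    rw [IntegrableOn, integrable_indicator_iff measurableSet_Ioo, IntegrableOn,
      Measure.restrict_restrict measurableSet_Ioo, inter_comm, Ioo_inter_Ioo_right hx] at this
    exact this

/-- Splitting the single integral requires both one-sided integrands to be integrable, which for a
general w is known only for almost every x. -/
lemma fracFlux_ae_eq {α : ℝ} (hα : α < 2) (r : ℝ) {w : ℝ → ℝ} (hw : IntegrableOn w (Ioo 0 1)) :
    fracFlux α r w =ᵐ[volume.restrict (Ioo (0 : ℝ) 1)]
      fun x => 1 / Real.Gamma (2 - α) * fluxOp α r w x := by
  filter_upwards [ae_integrableOn_powKer hα hw, ae_restrict_mem measurableSet_Ioo] with x h hx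
  have e : fluxOp α r w x = r * (∫ s in Ioo (0 : ℝ) 1, powKer α (x - s) * w s) +
      (1 - r) * ∫ s in Ioo (0 : ℝ) 1, powKer α (-(x - s)) * w s := by
    rw [fluxOp, ← integral_const_mul, ← integral_const_mul,
      ← integral_add (h.1.integrable.const_mul r) (h.2.integrable.const_mul (1 - r))]
    refine integral_congr_ae (Eventually.of_forall fun s => ?_)
    simp only [fluxKer]
    ring
  rw [fracFlux, leftFracInt_eq hx, rightFracInt_eq hx, e]
  ring

lemma integrableOn_fluxOp {α : ℝ} (hα : α < 2) (r : ℝ) {w : ℝ → ℝ}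
    (hw : IntegrableOn w (Ioo 0 1)) : IntegrableOn (fluxOp α r w) (Ioo 0 1) :=
  (integrable_prod_comp_sub_mul (integrable_fluxKer hα r) hw (Ioo 0 1)).integral_prod_left

lemma stronglyMeasurable_fluxOp (α r : ℝ) {ψ : ℝ → ℝ} (hψ : Continuous ψ) :
    StronglyMeasurable (fluxOp α r ψ) := by
  have m := measurable_fluxKer α r
  have m2 := hψ.measurable
  exact StronglyMeasurable.integral_prod_right'
    (f := fun p : ℝ × ℝ => fluxKer α r (p.1 - p.2) * ψ p.2)
    (Measurable.stronglyMeasurable (by fun_prop))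

lemma abs_fluxOp_le {α : ℝ} (hα : α < 2) (r : ℝ) {ψ : ℝ → ℝ} {M : ℝ} (hM : ∀ x, ‖ψ x‖ ≤ M)
    (x : ℝ) : ‖fluxOp α r ψ x‖ ≤ (∫ z, ‖fluxKer α r z‖) * M := by
  have hM0 : 0 ≤ M := (norm_nonneg _).trans (hM 0)
  have hi : Integrable fun s => ‖fluxKer α r (x - s)‖ :=
    ((integrable_fluxKer hα r).comp_sub_left x).norm
  calc ‖fluxOp α r ψ x‖ ≤ ∫ s in Ioo (0 : ℝ) 1, ‖fluxKer α r (x - s)‖ * M := by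
        refine norm_integral_le_of_norm_le (hi.integrableOn.integrable.mul_const M)
          (Eventually.of_forall fun s => ?_)
        rw [norm_mul]
        exact mul_le_mul_of_nonneg_left (hM s) (norm_nonneg _)
    _ = (∫ s in Ioo (0 : ℝ) 1, ‖fluxKer α r (x - s)‖) * M := integral_mul_const _ _
    _ ≤ (∫ s, ‖fluxKer α r (x - s)‖) * M := by
        refine mul_le_mul_of_nonneg_right ?_ hM0
        exact setIntegral_le_integral hi (Eventually.of_forall fun s => norm_nonneg _)
    _ = _ := by rw [integral_sub_left_eq_self (fun z => ‖fluxKer α r z‖)]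

/-- Transposition for arbitrary integrable w, paired with bounded continuous functions; it lets the
operator act on φ' while q is only in L¹. -/
lemma integral_fluxOp_mul {α : ℝ} (hα : α < 2) (r : ℝ) {w ψ : ℝ → ℝ}
    (hw : IntegrableOn w (Ioo 0 1)) (hψ : Continuous ψ) {M : ℝ} (hM : ∀ x, ‖ψ x‖ ≤ M) :
    ∫ x in Ioo (0 : ℝ) 1, fluxOp α r w x * ψ x =
      ∫ s in Ioo (0 : ℝ) 1, w s * fluxOp α (1 - r) ψ s := by
  have hi : Integrable (fun p : ℝ × ℝ => fluxKer α r (p.1 - p.2) * w p.2 * ψ p.1)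
      ((volume.restrict (Ioo (0 : ℝ) 1)).prod (volume.restrict (Ioo (0 : ℝ) 1))) :=
    (integrable_prod_comp_sub_mul (integrable_fluxKer hα r) hw (Ioo 0 1)).mul_bdd (c := M)
      (hψ.comp continuous_fst).aestronglyMeasurable (Eventually.of_forall fun p => hM p.1)
  unfold fluxOp
  simp_rw [← integral_mul_const, ← integral_const_mul]
  rw [integral_integral_swap hi]
  refine integral_congr_ae (Eventually.of_forall fun s => ?_)
  refine integral_congr_ae (Eventually.of_forall fun x => ?_)
  simp only
  rw [← fluxKer_neg, neg_sub]
  ring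

lemma integrableOn_mul_fluxOp {α : ℝ} (hα : α < 2) (r : ℝ) {w ψ : ℝ → ℝ}
    (hw : IntegrableOn w (Ioo 0 1)) (hψ : Continuous ψ) {M : ℝ} (hM : ∀ x, ‖ψ x‖ ≤ M) :
    IntegrableOn (fun s => w s * fluxOp α r ψ s) (Ioo 0 1) :=
  hw.integrable.mul_bdd (stronglyMeasurable_fluxOp α r hψ).aestronglyMeasurable
    (Eventually.of_forall fun x => abs_fluxOp_le hα r hM x)

lemma integral_eval_mul_deriv {φ : ℝ → ℝ} (hφ : ContDiff ℝ ∞ φ) (h0 : φ 0 = 0) (h1 : φ 1 = 0)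
    (Q : ℝ[X]) :
    ∫ x in Ioo (0 : ℝ) 1, Q.eval x * deriv φ x =
      -∫ x in Ioo (0 : ℝ) 1, (derivative Q).eval x * φ x := by
  have hd : Continuous (deriv φ) := hφ.continuous_deriv (by simp)
  rw [← integral_Ioc_eq_integral_Ioo, ← intervalIntegral.integral_of_le zero_le_one,
    ← integral_Ioc_eq_integral_Ioo, ← intervalIntegral.integral_of_le zero_le_one,
    intervalIntegral.integral_mul_deriv_eq_deriv_mul (u := fun x => Q.eval x) (v := φ)
      (fun x _ => Q.hasDerivAt x)
      (fun x _ => ((hφ.differentiable (by simp)) x).hasDerivAt)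
      ((derivative Q).continuous.intervalIntegrable _ _) (hd.intervalIntegrable _ _), h0, h1]
  simp

/-! ### The spectral series and its limit -/

section Solution

variable {α β r : ℝ}

lemma integrableOn_singPart (h : Admissible α β (α - β) r) (f : ℝ → ℝ) :
    IntegrableOn (singPart α β f) (Ioo 0 1) := by
  have := (h.integrableOn_rho_mul_eval' X).integrable.const_mul (cNegOne α β f)
  refine this.congr (Eventually.of_forall fun x => ?_)
  simp only [singPart, kerFun, rho, eval_X]
  ring

lemma integrableOn_rho_mul_jacobiG (h : Admissible α β (α - β) r) (n : ℕ) :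
    IntegrableOn (fun x => rho (α - β) β x * jacobiG n (α - β) β x) (Ioo 0 1) :=
  integrableOn_rho_mul (by linarith [h.γ_pos]) (by linarith [h.β_pos]) (continuous_jacobiG _ _ _)

lemma integral_singPart_mul (h : Admissible α β (α - β) r) (f : ℝ → ℝ) {φ : ℝ → ℝ}
    (hφ : ContDiff ℝ ∞ φ) (h0 : φ 0 = 0) (h1 : φ 1 = 0) :
    ∫ x in Ioo (0 : ℝ) 1, fluxOp α r (singPart α β f) x * deriv φ x =
      -Real.Gamma (2 - α) * (fCoeff α β f 0 / normSqG 0 (β - 1) (α - β - 1) *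
        ∫ x in Ioo (0 : ℝ) 1, φ x * jacobiG 0 (β - 1) (α - β - 1) x) := by
  obtain ⟨Q, hQ, hQx⟩ := h.exists_fluxOp_id_mul_rho
  rw [fluxCoeff_one h.one_lt h.lt_two] at hQ
  have hlam : lamNegOne α β ≠ 0 := by
    rw [lamNegOne]
    have h1 := (Real.Gamma_pos_of_pos (show 0 < α by linarith [h.one_lt])).ne'
    have h2 := (sin_pi_mul_neg h.one_lt h.lt_two).ne
    exact neg_ne_zero.mpr (div_ne_zero (mul_ne_zero h1 h2) h.S_pos.ne')
  have e1 : ∀ x ∈ Ioo (0 : ℝ) 1,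
      fluxOp α r (singPart α β f) x * deriv φ x = cNegOne α β f * (Q.eval x * deriv φ x) := by
    intro x hx
    rw [← hQx x hx, fluxOp, fluxOp, ← mul_assoc, ← integral_const_mul]
    congr 1
    refine integral_congr_ae (Eventually.of_forall fun s => ?_)
    simp only [singPart, kerFun, rho]
    ring
  have hn := (normSqG_pos 0 (show -1 < β - 1 by linarith [h.β_pos])
    (show -1 < α - β - 1 by linarith [h.γ_pos])).ne'
  rw [setIntegral_congr_fun measurableSet_Ioo e1, integral_const_mul,
    integral_eval_mul_deriv hφ h0 h1, hQ]
  simp_rw [eval_C]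
  rw [integral_const_mul]
  simp_rw [← eval_jacobiPoly, jacobiPoly_zero, eval_one, mul_one]
  rw [cNegOne]
  field_simp

lemma integral_rho_jacobiG_mul (h : Admissible α β (α - β) r) (n : ℕ) {φ : ℝ → ℝ}
    (hφ : ContDiff ℝ ∞ φ) (h0 : φ 0 = 0) (h1 : φ 1 = 0) :
    ∫ x in Ioo (0 : ℝ) 1,
        fluxOp α r (fun s => rho (α - β) β s * jacobiG n (α - β) β s) x * deriv φ x =
      -Real.Gamma (2 - α) * (lam α β n *
        ∫ x in Ioo (0 : ℝ) 1, φ x * jacobiG (n + 1) (β - 1) (α - β - 1) x) := by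
  obtain ⟨Q, hQ, hQx⟩ := h.exists_fluxOp_rho_jacobi n
  rw [succ_mul_fluxCoeff_succ h.one_lt h.lt_two, neg_neg] at hQ
  have e1 : ∀ x ∈ Ioo (0 : ℝ) 1,
      fluxOp α r (fun s => rho (α - β) β s * jacobiG n (α - β) β s) x * deriv φ x =
        Q.eval x * deriv φ x := fun x hx => by rw [hQx x hx]
  rw [setIntegral_congr_fun measurableSet_Ioo e1, integral_eval_mul_deriv hφ h0 h1, hQ,
    neg_mul, ← mul_assoc, ← integral_const_mul]
  congr 1
  refine integral_congr_ae (Eventually.of_forall fun x => ?_)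
  simp only [eval_mul, eval_C, eval_jacobiPoly]
  ring

lemma lam_ne_zero (h : Admissible α β (α - β) r) (n : ℕ) : lam α β n ≠ 0 := by
  have h1 := h.one_lt
  have hΓ : Real.Gamma (n + α) ≠ 0 := (Real.Gamma_pos_of_pos (by positivity)).ne'
  have h2 := (sin_pi_mul_neg h.one_lt h.lt_two).ne
  have h4 : (n.factorial : ℝ) ≠ 0 := by positivity
  exact mul_ne_zero (div_ne_zero h2 h.S_pos.ne') (div_ne_zero hΓ h4)

/-- Consecutive ratios are (n+α)/(n+1) ≥ 1, so dividing by λ_n never does worse than dividing by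
λ_0. -/
lemma lam_sq_ge (h : Admissible α β (α - β) r) (n : ℕ) : lam α β 0 ^ 2 ≤ lam α β n ^ 2 := by
  induction n with
  | zero => exact le_rfl
  | succ n ih =>
    rw [lam_succ h.one_lt, mul_pow]
    have h1 : 1 ≤ ((n : ℝ) + α) / ((n : ℝ) + 1) := by
      rw [le_div_iff₀ (by positivity)]
      linarith [h.one_lt]
    exact ih.trans (le_mul_of_one_le_right (sq_nonneg _) (one_le_pow₀ h1))

/-- The norm recurrence has ratio (n+α)/(n+1) ≥ 1; it produces the parameters (β, α-β), and
reflection swaps them. -/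
lemma normSqG_swap_le (h : Admissible α β (α - β) r) (n : ℕ) :
    normSqG n (α - β) β ≤ normSqG (n + 1) (β - 1) (α - β - 1) := by
  have hβ : -1 < β - 1 := by linarith [h.β_pos]
  have hγ : -1 < α - β - 1 := by linarith [h.γ_pos]
  have h1 := normSqG_succ n hβ hγ
  rw [sub_add_cancel, sub_add_cancel, normSqG_comm n β] at h1
  have h2 : 0 < normSqG n (α - β) β :=
    normSqG_pos n (by linarith [h.γ_pos]) (by linarith [h.β_pos])
  have h3 : (0 : ℝ) < (n : ℝ) + 1 := by positivity
  refine le_of_mul_le_mul_left ?_ h3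
  rw [h1]
  exact mul_le_mul_of_nonneg_right (by linarith [h.one_lt]) h2.le

lemma memLp_partialSum (h : Admissible α β (α - β) r) (f : ℝ → ℝ) (N : ℕ) :
    MemLp (fun x => qApprox α β f N x - singPart α β f x) 2
      (weightedMeasure (-(α - β)) (-β)) := by
  simp only [qApprox, add_sub_cancel_left]
  refine memLp_rho_mul_weighted (by linarith [h.γ_pos]) (by linarith [h.β_pos]) ?_
  exact continuous_finsetSum _ fun i _ => continuous_const.mul (continuous_jacobiG _ _ _)

/-- In the orthonormal system ρ^{(α-β,β)} times normalised Jacobi polynomials, the coefficients are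
c_i |||G_i|||. The bounds on λ_i and on the norms dominate their squares by the Bessel terms of f.
-/
lemma exists_isSpectralLimit (h : Admissible α β (α - β) r) {f : ℝ → ℝ}
    (hf : MemLp f 2 (weightedMeasure (β - 1) (α - β - 1))) :
    ∃ q : ℝ → ℝ, IsSpectralLimit α β f q := by
  have hβ : -1 < β - 1 := by linarith [h.β_pos]
  have hγ : -1 < α - β - 1 := by linarith [h.γ_pos]
  have hβ' : -1 < β := by linarith
  have hγ' : -1 < α - β := by linarith
  -- The shift by one reflects that c_i uses f_{i+1}; the coefficient f_0 belongs to the singular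
  -- part.
  have hsum := (summable_nat_add_iff 1).mpr (summable_jacobi_coeff_sq hβ hγ hf)
  have hl := lam_ne_zero h
  have hd : Summable fun i => (cCoeff α β f i * √(normSqG i (α - β) β)) ^ 2 := by
    refine Summable.of_nonneg_of_le (fun i => sq_nonneg _) (fun i => ?_)
      (hsum.mul_left (1 / lam α β 0 ^ 2))
    have n1 := normSqG_pos (i + 1) hβ hγ
    have n2 := normSqG_pos i hγ' hβ'
    rw [mul_pow, Real.sq_sqrt n2.le]
    have e : cCoeff α β f i ^ 2 = 1 / lam α β i ^ 2 *
        (fCoeff α β f (i + 1) ^ 2 / normSqG (i + 1) (β - 1) (α - β - 1)) *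
          (1 / normSqG (i + 1) (β - 1) (α - β - 1)) := by
      have := hl i
      rw [cCoeff]
      field_simp
    rw [e, mul_assoc]
    have h1 : 1 / normSqG (i + 1) (β - 1) (α - β - 1) * normSqG i (α - β) β ≤ 1 := by
      rw [one_div_mul_eq_div, div_le_one n1]
      exact normSqG_swap_le h i
    have h2 : 1 / lam α β i ^ 2 ≤ 1 / lam α β 0 ^ 2 :=
      one_div_le_one_div_of_le (by have := hl 0; positivity) (lam_sq_ge h i)
    calc _ ≤ 1 / lam α β i ^ 2 *
          (fCoeff α β f (i + 1) ^ 2 / normSqG (i + 1) (β - 1) (α - β - 1)) * 1 := by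
          refine mul_le_mul_of_nonneg_left h1 ?_
          positivity
      _ ≤ 1 / lam α β 0 ^ 2 *
          (fCoeff α β f (i + 1) ^ 2 / normSqG (i + 1) (β - 1) (α - β - 1)) := by
          rw [mul_one]
          exact mul_le_mul_of_nonneg_right h2 (by positivity)
  obtain ⟨g, hg, hlim⟩ := exists_tendsto_of_summable_sq
    (fun i => memLp_rho_mul_weighted hγ' hβ' (continuous_jacobiN i (α - β) β))
    (rho_jacobiN_orthonormal_weighted hγ' hβ') hd
  refine ⟨fun x => g x + singPart α β f x, by simpa using hg, hlim.congr fun N => ?_⟩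
  congr 1
  funext x
  simp only [Pi.sub_apply, qApprox, add_sub_cancel_right, add_sub_cancel_left, Finset.mul_sum]
  congr 1
  refine Finset.sum_congr rfl fun i _ => ?_
  have hs : √(normSqG i (α - β) β) ≠ 0 := (Real.sqrt_pos.mpr (normSqG_pos i hγ' hβ')).ne'
  rw [jacobiN]
  field_simp

lemma integrableOn_qApprox (h : Admissible α β (α - β) r) (f : ℝ → ℝ) (N : ℕ) :
    IntegrableOn (qApprox α β f N) (Ioo 0 1) := by
  have hsum : Integrable (fun x => ∑ i ∈ Finset.range N,
      cCoeff α β f i * (rho (α - β) β x * jacobiG i (α - β) β x))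
      (volume.restrict (Ioo (0 : ℝ) 1)) :=
    integrable_finsetSum _ fun i _ => (integrableOn_rho_mul_jacobiG h i).integrable.const_mul _
  refine ((integrableOn_singPart h f).integrable.add hsum).congr
    (Eventually.of_forall fun x => ?_)
  simp only [Pi.add_apply, qApprox, Finset.mul_sum]
  congr 1
  exact Finset.sum_congr rfl fun i _ => by ring

/-- The weak form of `𝒩_r^α q_N = ∑_{i ≤ N} f_i G_i / |||G_i|||²`. -/
lemma integral_qApprox_mul (h : Admissible α β (α - β) r) (f : ℝ → ℝ) {φ : ℝ → ℝ}
    (hφ : ContDiff ℝ ∞ φ) (h0 : φ 0 = 0) (h1 : φ 1 = 0) {M : ℝ} (hM : ∀ x, ‖deriv φ x‖ ≤ M)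
    (N : ℕ) :
    ∫ s in Ioo (0 : ℝ) 1, qApprox α β f N s * fluxOp α (1 - r) (deriv φ) s =
      -Real.Gamma (2 - α) * ∑ i ∈ Finset.range (N + 1),
        fCoeff α β f i / normSqG i (β - 1) (α - β - 1) *
          ∫ x in Ioo (0 : ℝ) 1, φ x * jacobiG i (β - 1) (α - β - 1) x := by
  have hd : Continuous (deriv φ) := hφ.continuous_deriv (by simp)
  have hi : ∀ i, IntegrableOn (fun s => rho (α - β) β s * jacobiG i (α - β) β s *
      fluxOp α (1 - r) (deriv φ) s) (Ioo 0 1) := fun i =>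
    integrableOn_mul_fluxOp h.lt_two (1 - r) (integrableOn_rho_mul_jacobiG h i) hd hM
  have hsp := integrableOn_mul_fluxOp h.lt_two (1 - r) (integrableOn_singPart h f) hd hM
  have e : ∀ s, qApprox α β f N s * fluxOp α (1 - r) (deriv φ) s =
      singPart α β f s * fluxOp α (1 - r) (deriv φ) s +
        ∑ i ∈ Finset.range N, cCoeff α β f i *
          (rho (α - β) β s * jacobiG i (α - β) β s * fluxOp α (1 - r) (deriv φ) s) := fun s => by
    rw [qApprox, add_mul, Finset.mul_sum, Finset.sum_mul]
    congr 1
    exact Finset.sum_congr rfl fun i _ => by ring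
  simp_rw [e]
  -- `Finset.sum_range_succ'` splits off index 0, which is the contribution of the singular part.
  rw [integral_add hsp.integrable (integrable_finsetSum _ fun i _ =>
      (hi i).integrable.const_mul _),
    integral_finsetSum _ fun i _ => (hi i).integrable.const_mul _,
    ← integral_fluxOp_mul h.lt_two r (integrableOn_singPart h f) hd hM,
    integral_singPart_mul h f hφ h0 h1, Finset.sum_range_succ', add_comm, mul_add]
  congr 1
  rw [Finset.mul_sum]
  refine Finset.sum_congr rfl fun i _ => ?_
  rw [integral_const_mul, ← integral_fluxOp_mul h.lt_two r (integrableOn_rho_mul_jacobiG h i) hd hM,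
    integral_rho_jacobiG_mul h i hφ h0 h1, cCoeff]
  have hl := lam_ne_zero h i
  have hn := (normSqG_pos (i + 1) (show -1 < β - 1 by linarith [h.β_pos])
    (show -1 < α - β - 1 by linarith [h.γ_pos])).ne'
  field_simp

/-- Parseval applied to φ/ρ in place of φ removes the weight; φ/ρ lies in the weighted space because
ρ ≥ 1 makes it bounded and the measure is finite. -/
lemma hasSum_test (h : Admissible α β (α - β) r) {f : ℝ → ℝ}
    (hf : MemLp f 2 (weightedMeasure (β - 1) (α - β - 1))) {φ : ℝ → ℝ} (hφ : Continuous φ)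
    {M : ℝ} (hM : ∀ x, ‖φ x‖ ≤ M) :
    HasSum (fun i => fCoeff α β f i / normSqG i (β - 1) (α - β - 1) *
        ∫ x in Ioo (0 : ℝ) 1, φ x * jacobiG i (β - 1) (α - β - 1) x)
      (∫ x in Ioo (0 : ℝ) 1, f x * φ x) := by
  have hβ : -1 < β - 1 := by linarith [h.β_pos]
  have hγ : -1 < α - β - 1 := by linarith [h.γ_pos]
  have hfin := isFiniteMeasure_weightedMeasure hβ hγ
  have hp : MemLp (fun x => φ x / rho (β - 1) (α - β - 1) x) 2
      (weightedMeasure (β - 1) (α - β - 1)) := by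
    refine MemLp.of_bound
      (hφ.measurable.div (measurable_rho _ _)).aestronglyMeasurable M ?_
    filter_upwards [ae_mem_Ioo_weightedMeasure _ _] with x hx
    have h1 : 1 ≤ rho (β - 1) (α - β - 1) x :=
      one_le_mul_of_one_le_of_one_le
        (Real.one_le_rpow_of_pos_of_le_one_of_nonpos (by linarith [hx.2]) (by linarith [hx.1])
          (by linarith [h.β_le]))
        (Real.one_le_rpow_of_pos_of_le_one_of_nonpos hx.1 hx.2.le (by linarith [h.γ_le]))
    rw [norm_div, Real.norm_of_nonneg (zero_le_one.trans h1)]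
    exact (div_le_self (norm_nonneg _) h1).trans (hM x)
  have key := hasSum_jacobi_coeff hβ hγ hf hp
  have e1 : ∀ i, ∫ x in Ioo (0 : ℝ) 1, rho (β - 1) (α - β - 1) x *
      (φ x / rho (β - 1) (α - β - 1) x) * jacobiG i (β - 1) (α - β - 1) x =
      ∫ x in Ioo (0 : ℝ) 1, φ x * jacobiG i (β - 1) (α - β - 1) x := fun i => by
    refine setIntegral_congr_fun measurableSet_Ioo fun x hx => ?_
    rw [mul_div_cancel₀ _ (rho_pos _ _ hx).ne']
  have e2 : ∫ x in Ioo (0 : ℝ) 1, rho (β - 1) (α - β - 1) x * f x *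
      (φ x / rho (β - 1) (α - β - 1) x) = ∫ x in Ioo (0 : ℝ) 1, f x * φ x := by
    refine setIntegral_congr_fun measurableSet_Ioo fun x hx => ?_
    have := (rho_pos (β - 1) (α - β - 1) hx).ne'
    field_simp
  simp_rw [e1] at key
  rw [e2] at key
  exact key

lemma integrableOn_of_isSpectralLimit (h : Admissible α β (α - β) r) {f q : ℝ → ℝ}
    (hq : IsSpectralLimit α β f q) : IntegrableOn q (Ioo 0 1) := by
  have h1 := integrableOn_of_memLp_weighted (by linarith [h.γ_pos]) (by linarith [h.β_pos]) hq.1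
  refine (h1.integrable.add (integrableOn_singPart h f).integrable).congr
    (Eventually.of_forall fun x => ?_)
  simp

/-- The singular parts of q_N and q cancel in the difference, so convergence in the weighted space
gives L¹ convergence, which suffices against a bounded Φ. -/
lemma tendsto_integral_qApprox_mul (h : Admissible α β (α - β) r) {f q : ℝ → ℝ}
    (hq : IsSpectralLimit α β f q) {Φ : ℝ → ℝ} (hΦ : StronglyMeasurable Φ) {M : ℝ}
    (hM : ∀ x, ‖Φ x‖ ≤ M) :
    Tendsto (fun N => ∫ s in Ioo (0 : ℝ) 1, qApprox α β f N s * Φ s) atTop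
      (𝓝 (∫ s in Ioo (0 : ℝ) 1, q s * Φ s)) := by
  have hint : ∀ {w : ℝ → ℝ}, IntegrableOn w (Ioo 0 1) →
      Integrable (fun s => w s * Φ s) (volume.restrict (Ioo (0 : ℝ) 1)) := fun hw =>
    hw.integrable.mul_bdd hΦ.aestronglyMeasurable (Eventually.of_forall hM)
  refine tendsto_integral_of_L1' _ (hint (integrableOn_of_isSpectralLimit h hq)).aestronglyMeasurable
    (Eventually.of_forall fun N => hint (integrableOn_qApprox h f N)) ?_
  have hlim := hq.2
  have hlim2 := ENNReal.Tendsto.const_mul hlim (a := ENNReal.ofReal M)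
    (Or.inr ENNReal.ofReal_ne_top)
  rw [mul_zero] at hlim2
  refine tendsto_of_tendsto_of_tendsto_of_le_of_le tendsto_const_nhds hlim2
    (fun _ => zero_le) fun N => ?_
  have hm := (memLp_partialSum h f N).sub hq.1
  refine le_trans ?_ (mul_le_mul_right (eLpNorm_one_le_weighted (by linarith [h.γ_pos])
    (by linarith [h.β_pos]) hm.aestronglyMeasurable) (ENNReal.ofReal M))
  refine eLpNorm_le_mul_eLpNorm_of_ae_le_mul (Eventually.of_forall fun s => ?_) 1
  simp only [Pi.sub_apply]
  rw [← sub_mul, norm_mul, mul_comm, sub_sub_sub_cancel_right]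
  exact mul_le_mul_of_nonneg_right (hM s) (norm_nonneg _)

/-- The weak identity for q_N passes to the limit on both sides, by L¹ convergence on the left and
the Jacobi expansion of f on the right; uniqueness of limits identifies the two. -/
lemma solvesN_of_isSpectralLimit (h : Admissible α β (α - β) r) {f q : ℝ → ℝ}
    (hf : MemLp f 2 (weightedMeasure (β - 1) (α - β - 1))) (hq : IsSpectralLimit α β f q) :
    SolvesN α r q f := by
  have hqi := integrableOn_of_isSpectralLimit h hq
  have hflux := fracFlux_ae_eq h.lt_two r hqi
  refine ⟨ae_integrableOn_fracInt h.lt_two hqi, ?_, ?_, fun φ hφ hφc hφs => ?_⟩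
  · refine IntegrableOn.locallyIntegrableOn ?_
    exact ((integrableOn_fluxOp h.lt_two r hqi).integrable.const_mul _).congr hflux.symm
  · exact (integrableOn_of_memLp_weighted (by linarith [h.β_le]) (by linarith [h.γ_le])
      hf).locallyIntegrableOn
  · have h0 : φ 0 = 0 := image_eq_zero_of_notMem_tsupport fun h' => by simpa using hφs h'
    have h1 : φ 1 = 0 := image_eq_zero_of_notMem_tsupport fun h' => by simpa using hφs h'
    have hd : Continuous (deriv φ) := hφ.continuous_deriv (by simp)
    obtain ⟨M, hM⟩ := hφc.exists_bound_of_continuous hφ.continuous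
    obtain ⟨M', hM'⟩ := hφc.deriv.exists_bound_of_continuous hd
    have hΓ : Real.Gamma (2 - α) ≠ 0 :=
      (Real.Gamma_pos_of_pos (by linarith [h.lt_two])).ne'
    have t1 := tendsto_integral_qApprox_mul h hq
      (stronglyMeasurable_fluxOp α (1 - r) hd) (abs_fluxOp_le h.lt_two (1 - r) hM')
    simp_rw [integral_qApprox_mul h f hφ h0 h1 hM'] at t1
    -- The sequence is shifted because q_N corresponds to N+1 terms of the expansion of f.
    have t2 := (((hasSum_test h hf hφ.continuous hM).tendsto_sum_nat).comp
      (tendsto_add_atTop_nat 1)).const_mul (-Real.Gamma (2 - α))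
    have huniq := tendsto_nhds_unique t1 t2
    rw [← integral_fluxOp_mul h.lt_two r hqi hd hM'] at huniq
    calc _ = ∫ x in Ioo (0 : ℝ) 1,
          1 / Real.Gamma (2 - α) * (fluxOp α r q x * deriv φ x) := by
          refine integral_congr_ae ?_
          filter_upwards [hflux] with x hx
          rw [hx]; ring
      _ = _ := by
          rw [integral_const_mul, huniq]
          field_simp

end Solution

end SpectralFDE

theorem mainTheorem1 (α β r : ℝ) (hα₁ : 1 < α) (hα₂ : α < 2)
    (hr₀ : 1 / 2 ≤ r) (hr₁ : r ≤ 1)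
    (hβ : α - 1 ≤ β ∧ β ≤ 1) (hαβ : α - 1 ≤ α - β ∧ α - β ≤ 1)
    (hrβ : r = Real.sin (Real.pi * β) /
      (Real.sin (Real.pi * (α - β)) + Real.sin (Real.pi * β)))
    (f : ℝ → ℝ)
    (hf : MemLp f 2 (SpectralFDE.weightedMeasure (β - 1) (α - β - 1))) :
    (∀ N : ℕ, MemLp
      (fun x => SpectralFDE.qApprox α β f N x - SpectralFDE.singPart α β f x) 2
      (SpectralFDE.weightedMeasure (-(α - β)) (-β))) ∧
    (∃ q : ℝ → ℝ, SpectralFDE.IsSpectralLimit α β f q) ∧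
    ∀ q : ℝ → ℝ, SpectralFDE.IsSpectralLimit α β f q → SpectralFDE.SolvesN α r q f := by
  -- Positivity of β and α-β comes from their lower bound α-1 > 0.
  have h : SpectralFDE.Admissible α β (α - β) r :=
    ⟨hα₁, hα₂, by ring, by linarith [hβ.1], hβ.2, by linarith [hαβ.1], hαβ.2, hrβ⟩
  exact ⟨SpectralFDE.memLp_partialSum h f, SpectralFDE.exists_isSpectralLimit h hf,
    fun _ hq => SpectralFDE.solvesN_of_isSpectralLimit h hf hq⟩
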